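/- There are $n$ boxes with promised values $v_1\ge v_2\ge\dots\ge v_n>0$ (real numbers), and integers $1\le t<n$ and $1\le\ell<n$. For a probability distribution $p$ over the $\ell$-element subsets of $[n]=\{1,\dots,n\}$ let $$\mathrm{val}(p)=\min_{B\subseteq[n],\,|B|=t}\ \mathbb{E}_{S\sim p}\Big[\sum_{i\in S\setminus B}v_i\Big]$$ be its worst-case expected payoff when $t$ of the boxes are (byzantine, i.e.) empty. Running times are the numbers of steps on a randomized real RAM: a machine with unit-cost exact arithmetic ($+,-,\cdot,/$) and comparisons on real numbers, addition, (truncated) subtraction and comparison of natural numbers, conversion of natural numbers to real numbers, indirect addressing, and an instruction that draws a fresh independent uniform random number from $[0,1]$, but without a rounding operation. Then: (1) There are a randomized program and a constant $C$ such that, for every input $(n,v,t,\ell)$ as above, the program always halts after at most $C\,n$ steps and outputs a random $\ell$-element subset of $[n]$ whose distribution $p$ maximizes $\mathrm{val}$ among all probability distributions over $\ell$-element subsets of $[n]$. (2) There are a deterministic program (one that draws no random numbers) and a constant $C$ such that, for every input $(n,v,t,\ell)$ as above, the program halts after at most $C\,n^2$ steps and outputs an explicit description (the list of the sets of positive probability,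 without repetition, and their probabilities) of a distribution $p$ over $\ell$-element subsets of $[n]$ that maximizes $\mathrm{val}$ among all such distributions and has support of size at most $n$. -/

import Mathlib

namespace Byzantine

/-! ## The selection problem -/

/-- The set `[n]^(k)` of `k`-element subsets of the `n` boxes (numbered `0, …, n - 1`). -/
abbrev Subsets (n k : ℕ) : Type := {S : Finset (Fin n) // S.card = k}

/-- Total payoff of opening the boxes in `S` when exactly the boxes in `B` are empty. -/
def pay {n : ℕ} (v : Fin n → ℝ) (S B : Finset (Fin n)) : ℝ :=
  ∑ i ∈ S, if i ∈ B then 0 else v i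

/-- Expected payoff of a distribution `p` over `ℓ`-subsets when the boxes in `B` are empty. -/
def expectedPay {n ℓ : ℕ} (v : Fin n → ℝ) (p : Subsets n ℓ → ℝ) (B : Finset (Fin n)) : ℝ :=
  ∑ S : Subsets n ℓ, p S * pay v S.1 B

/-- Worst-case expected payoff: the minimum over all sets of `t` empty boxes.  The index type is
finite, and nonempty when `t ≤ n`, so the infimum is a minimum. -/
noncomputable def val {n ℓ : ℕ} (v : Fin n → ℝ) (t : ℕ) (p : Subsets n ℓ → ℝ) : ℝ :=
  ⨅ B : Subsets n t, expectedPay v p B.1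

/-- `p` is a probability distribution over `ℓ`-subsets that maximizes the worst-case expected
payoff among all of them. -/
def IsOptimal {n ℓ : ℕ} (v : Fin n → ℝ) (t : ℕ) (p : Subsets n ℓ → ℝ) : Prop :=
  p ∈ stdSimplex ℝ (Subsets n ℓ) ∧ IsMaxOn (val v t) (stdSimplex ℝ (Subsets n ℓ)) p

/-! ## The machine model: a randomized real RAM

Programs work on natural-number variables and arrays (used for counting and addressing) and on
real variables and arrays.  The elementary operations are addition and truncated subtraction of
natural numbers, the four arithmetic operations on real numbers, the conversion of a natural number
to a real number, comparisons, array accesses with computed addresses, and the drawing of a fresh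
uniform random number from `[0, 1]`; each of them costs one step.  There is no rounding operation
(no conversion of real numbers to natural numbers), no multiplication of natural numbers, and
programs contain no real constants. -/

/-- An infinite sequence of random numbers in `[0, 1]`. -/
abbrev Tape : Type := ℕ → unitInterval

/-- Memory of the machine. -/
structure State where
  /-- natural-number variables -/
  nvar : ℕ → ℕ
  /-- real variables -/
  rvar : ℕ → ℝ
  /-- natural-number arrays: `narr a i` is cell `i` of array `a` -/
  narr : ℕ → ℕ → ℕ
  /-- real arrays: `rarr a i` is cell `i` of array `a` -/
  rarr : ℕ → ℕ → ℝ
  /-- the random numbers that have not been drawn yet -/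
  tape : Tape

/-- Natural-number expressions. -/
inductive NExp where
  | lit (k : ℕ)
  | var (x : ℕ)
  | arr (a : ℕ) (i : NExp)
  | add (e f : NExp)
  | sub (e f : NExp)

/-- Real expressions. -/
inductive RExp where
  | var (x : ℕ)
  | arr (a : ℕ) (i : NExp)
  | ofNat (e : NExp)
  | add (e f : RExp)
  | sub (e f : RExp)
  | mul (e f : RExp)
  | div (e f : RExp)

/-- Tests. -/
inductive BExp where
  | ltN (e f : NExp)
  | ltR (e f : RExp)
  | not (b : BExp)
  | and (b c : BExp)

/-- Programs. -/
inductive Prog where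
  | skip
  /-- assign to a natural-number variable -/
  | setN (x : ℕ) (e : NExp)
  /-- assign to a real variable -/
  | setR (x : ℕ) (e : RExp)
  /-- store `e` in cell `i` of the natural-number array `a` -/
  | storeN (a : ℕ) (i e : NExp)
  /-- store `e` in cell `i` of the real array `a` -/
  | storeR (a : ℕ) (i : NExp) (e : RExp)
  /-- draw a fresh uniform random number into the real variable `x` -/
  | draw (x : ℕ)
  | seq (c d : Prog)
  | cond (b : BExp) (c d : Prog)
  | loop (b : BExp) (c : Prog)

def NExp.eval (s : State) : NExp → ℕ
  | lit k => k
  | var x => s.nvar x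
  | arr a i => s.narr a (i.eval s)
  | add e f => e.eval s + f.eval s
  | sub e f => e.eval s - f.eval s

noncomputable def RExp.eval (s : State) : RExp → ℝ
  | var x => s.rvar x
  | arr a i => s.rarr a (i.eval s)
  | ofNat e => (e.eval s : ℝ)
  | add e f => e.eval s + f.eval s
  | sub e f => e.eval s - f.eval s
  | mul e f => e.eval s * f.eval s
  | div e f => e.eval s / f.eval s

def BExp.eval (s : State) : BExp → Prop
  | ltN e f => e.eval s < f.eval s
  | ltR e f => e.eval s < f.eval s
  | not b => ¬ b.eval s
  | and b c => b.eval s ∧ c.eval s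

/-- Number of steps needed to evaluate an expression: one for each node of the expression. -/
def NExp.cost : NExp → ℕ
  | lit _ => 1
  | var _ => 1
  | arr _ i => i.cost + 1
  | add e f => e.cost + f.cost + 1
  | sub e f => e.cost + f.cost + 1

/-- Number of steps needed to evaluate an expression: one for each node of the expression. -/
def RExp.cost : RExp → ℕ
  | var _ => 1
  | arr _ i => i.cost + 1
  | ofNat e => e.cost + 1
  | add e f => e.cost + f.cost + 1
  | sub e f => e.cost + f.cost + 1
  | mul e f => e.cost + f.cost + 1
  | div e f => e.cost + f.cost + 1

/-- Number of steps needed to evaluate a test: one for each node of the test. -/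
def BExp.cost : BExp → ℕ
  | ltN e f => e.cost + f.cost + 1
  | ltR e f => e.cost + f.cost + 1
  | not b => b.cost + 1
  | and b c => b.cost + c.cost + 1

def State.setN (s : State) (x k : ℕ) : State :=
  { s with nvar := Function.update s.nvar x k }

noncomputable def State.setR (s : State) (x : ℕ) (r : ℝ) : State :=
  { s with rvar := Function.update s.rvar x r }

def State.storeN (s : State) (a i k : ℕ) : State :=
  { s with narr := Function.update s.narr a (Function.update (s.narr a) i k) }

noncomputable def State.storeR (s : State) (a i : ℕ) (r : ℝ) : State :=
  { s with rarr := Function.update s.rarr a (Function.update (s.rarr a) i r) }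

noncomputable def State.draw (s : State) (x : ℕ) : State :=
  { s with rvar := Function.update s.rvar x (s.tape 0 : ℝ), tape := fun j => s.tape (j + 1) }

/-- `Exec c s T s'`: the program `c`, started in the state `s`, halts in the state `s'` after
exactly `T` steps. -/
inductive Exec : Prog → State → ℕ → State → Prop
  | skip (s : State) : Exec .skip s 1 s
  | setN (s : State) (x : ℕ) (e : NExp) :
      Exec (.setN x e) s (e.cost + 1) (s.setN x (e.eval s))
  | setR (s : State) (x : ℕ) (e : RExp) :
      Exec (.setR x e) s (e.cost + 1) (s.setR x (e.eval s))
  | storeN (s : State) (a : ℕ) (i e : NExp) :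
      Exec (.storeN a i e) s (i.cost + e.cost + 1) (s.storeN a (i.eval s) (e.eval s))
  | storeR (s : State) (a : ℕ) (i : NExp) (e : RExp) :
      Exec (.storeR a i e) s (i.cost + e.cost + 1) (s.storeR a (i.eval s) (e.eval s))
  | draw (s : State) (x : ℕ) : Exec (.draw x) s 1 (s.draw x)
  | seq {c d : Prog} {s s' s'' : State} {T U : ℕ} :
      Exec c s T s' → Exec d s' U s'' → Exec (.seq c d) s (T + U) s''
  | condTrue {b : BExp} {c d : Prog} {s s' : State} {T : ℕ} :
      b.eval s → Exec c s T s' → Exec (.cond b c d) s (b.cost + T + 1) s'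
  | condFalse {b : BExp} {c d : Prog} {s s' : State} {T : ℕ} :
      ¬ b.eval s → Exec d s T s' → Exec (.cond b c d) s (b.cost + T + 1) s'
  | loopStop {b : BExp} {c : Prog} {s : State} :
      ¬ b.eval s → Exec (.loop b c) s (b.cost + 1) s
  | loopStep {b : BExp} {c : Prog} {s s' s'' : State} {T U : ℕ} :
      b.eval s → Exec c s T s' → Exec (.loop b c) s' U s'' →
      Exec (.loop b c) s (b.cost + T + U + 1) s''

/-- For a fixed tape, the running time and the final state are determined by the program and the
initial state. -/
theorem Exec.deterministic {c : Prog} {s s₁ s₂ : State} {T₁ T₂ : ℕ}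
    (h₁ : Exec c s T₁ s₁) (h₂ : Exec c s T₂ s₂) : T₁ = T₂ ∧ s₁ = s₂ := by
  induction h₁ generalizing T₂ s₂ with
  | skip | setN | setR | storeN | storeR | draw => cases h₂; exact ⟨rfl, rfl⟩
  | seq _ _ ih₁ ih₂ =>
    cases h₂ with
    | seq a b =>
      obtain ⟨rfl, rfl⟩ := ih₁ a
      obtain ⟨rfl, rfl⟩ := ih₂ b
      exact ⟨rfl, rfl⟩
  | condTrue hb _ ih =>
    cases h₂ with
    | condTrue _ a => obtain ⟨rfl, rfl⟩ := ih a; exact ⟨rfl, rfl⟩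
    | condFalse hb' _ => exact absurd hb hb'
  | condFalse hb _ ih =>
    cases h₂ with
    | condTrue hb' _ => exact absurd hb' hb
    | condFalse _ a => obtain ⟨rfl, rfl⟩ := ih a; exact ⟨rfl, rfl⟩
  | loopStop hb =>
    cases h₂ with
    | loopStop => exact ⟨rfl, rfl⟩
    | loopStep hb' _ _ => exact absurd hb' hb
  | loopStep hb _ _ ih₁ ih₂ =>
    cases h₂ with
    | loopStop hb' => exact absurd hb hb'
    | loopStep _ a b =>
      obtain ⟨rfl, rfl⟩ := ih₁ a
      obtain ⟨rfl, rfl⟩ := ih₂ b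
      exact ⟨rfl, rfl⟩

/-- The program contains no instruction that draws a random number. -/
def Prog.DrawFree : Prog → Prop
  | .draw _ => False
  | .seq c d => c.DrawFree ∧ d.DrawFree
  | .cond _ c d => c.DrawFree ∧ d.DrawFree
  | .loop _ c => c.DrawFree
  | _ => True

/-! ## Input and output -/

/-- Initial memory on the input `(n, v, t, ℓ)` with random tape `ω`: the natural-number variables
`0, 1, 2` hold `n, t, ℓ`, the first `n` cells of the real array `0` hold the values of the boxes,
and everything else is zero. -/
noncomputable def initState {n : ℕ} (v : Fin n → ℝ) (t ℓ : ℕ) (ω : Tape) : State where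
  nvar x := if x = 0 then n else if x = 1 then t else if x = 2 then ℓ else 0
  rvar _ := 0
  narr _ _ := 0
  rarr a i := if a = 0 then (if h : i < n then v ⟨i, h⟩ else 0) else 0
  tape := ω

/-- The law of a sequence of independent uniform random numbers in `[0, 1]`. -/
noncomputable def tapeLaw : MeasureTheory.Measure Tape :=
  MeasureTheory.Measure.infinitePi
    (fun _ : ℕ => (MeasureTheory.volume : MeasureTheory.Measure unitInterval))

/-- The set of boxes whose indicator vector stands in the `n` cells `j * n, …, j * n + n - 1`
(row `j`) of the natural-number array `0`. -/
def outputRow (n : ℕ) (s : State) (j : ℕ) : Finset (Fin n) :=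
  Finset.univ.filter fun i : Fin n => s.narr 0 (j * n + i) = 1

/-- On the input `(n, v, t, ℓ)`, the program `c` halts after at most `T` steps whatever the random
numbers are, with an `ℓ`-subset of the boxes in row `0` of the output, and this random subset has
the distribution `p`. -/
def SamplesWithin (c : Prog) {n : ℕ} (v : Fin n → ℝ) (t ℓ T : ℕ) (p : Subsets n ℓ → ℝ) : Prop :=
  (∀ ω : Tape, ∃ k ≤ T, ∃ s, Exec c (initState v t ℓ ω) k s ∧ (outputRow n s 0).card = ℓ) ∧
  ∀ S : Subsets n ℓ,
    tapeLaw.real {ω | ∃ k s, Exec c (initState v t ℓ ω) k s ∧ outputRow n s 0 = S.1} = p S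

/-- The final state `s` describes `p` explicitly: with `m` the content of the natural-number
variable `0`, the output rows `0, …, m - 1` list the support of `p` without repetition, and the
cells `0, …, m - 1` of the real array `1` hold the corresponding probabilities. -/
def Describes {n ℓ : ℕ} (s : State) (p : Subsets n ℓ → ℝ) : Prop :=
  Set.InjOn (outputRow n s) (Set.Iio (s.nvar 0)) ∧
  (∀ j < s.nvar 0, ∃ S : Subsets n ℓ, p S ≠ 0 ∧ outputRow n s j = S.1 ∧ s.rarr 1 j = p S) ∧
  ∀ S : Subsets n ℓ, p S ≠ 0 → ∃ j < s.nvar 0, outputRow n s j = S.1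

/-- On the input `(n, v, t, ℓ)`, the program `c` uses no random numbers and halts after at most
`T` steps with an explicit description of `p` as its output. -/
def ComputesWithin (c : Prog) {n : ℕ} (v : Fin n → ℝ) (t ℓ T : ℕ) (p : Subsets n ℓ → ℝ) : Prop :=
  c.DrawFree ∧
  ∀ ω : Tape, ∃ k ≤ T, ∃ s, Exec c (initState v t ℓ ω) k s ∧ Describes s p

end Byzantine

namespace Byzantine

open MeasureTheory Set

/-! ## Systematic sampling -/

/-! By linearity, a distribution over `ℓ`-sets matters only through its marginals `x i` in `[0, 1]`,
which sum to `ℓ`; conversely, systematic sampling realizes every such vector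
(`marginal_systematicLaw`). The problem is thus a zero-sum game between `x` and the survival
probabilities `w i` chosen by an adversary, which sum to `n - t`, with payoff `∑ w i * v i * x i`. A
saddle point is recognized by complementary slackness: `x` favours large `w i * v i`, and `w`
favours small `v i * x i` (`isOptimal_of_certificate`).

An optimal `x` is sought among threshold vectors: the first `r` boxes contribute `tau` each, the
boxes up to `k` are opened surely, and box `k` takes the leftover mass. Lowering `tau` shifts mass
from the first `r` boxes to box `k`; per unit, for `t ≤ r`, the payoff loses `r - t` and gains `V k
* invSum V r`. The search lowers `tau` through the breakpoints where `r` or `k` changes, until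
lowering no longer gains or the boxes are exhausted. The slopes on the two sides of the last
breakpoint supply the inequalities needed to construct `w` (`isOptimal_searchResult`). Every move
raises `r` or `k`, so linearly many moves suffice.

As a function of its starting point in `[0, 1)`, the systematic sample is piecewise constant and
jumps only at fractional parts of partial sums of `x`. As the full sum is an integer, there are at
most `n` pieces (`le_of_starts_lt`); different pieces give different samples
(`systematic_ne_of_nextStart_le`), and the lengths of the pieces are the probabilities. One pass
over the boxes yields the sample and the end of its piece. A pass with a random start is the
linear-time sampler; at most `n` passes, each starting where the previous piece ended, produce the
list in quadratic time. -/

/-- The number of points `u, u + 1, u + 2, …` lying below the partial sum `x 0 + ⋯ + x (i - 1)`. -/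
noncomputable def hits (x : ℕ → ℝ) (u : ℝ) (i : ℕ) : ℕ := ⌈∑ j ∈ Finset.range i, x j - u⌉₊

/-- Systematic sampling: box `i` is selected when one of the points `u, u + 1, …` falls into the
`i`-th of the consecutive intervals with lengths `x 0, x 1, …`. -/
noncomputable def systematic (n : ℕ) (x : ℕ → ℝ) (u : ℝ) : Finset (Fin n) :=
  Finset.univ.filter fun i : Fin n => hits x u i < hits x u (i + 1)

/-- The uniform distribution on `[0, 1)`. -/
noncomputable def unitLaw : Measure ℝ := volume.restrict (Ico 0 1)

/-- The distribution of the systematic sample for a uniform starting point. -/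
noncomputable def systematicLaw (n ℓ : ℕ) (x : ℕ → ℝ) (S : Subsets n ℓ) : ℝ :=
  unitLaw.real (systematic n x ⁻¹' {S.1})

theorem hits_zero {x : ℕ → ℝ} {u : ℝ} (hu : 0 ≤ u) : hits x u 0 = 0 := by
  simp [hits, hu]

theorem lt_hits_iff {x : ℕ → ℝ} {u : ℝ} {i m : ℕ} :
    m < hits x u i ↔ (m : ℝ) < ∑ j ∈ Finset.range i, x j - u := Nat.lt_ceil

theorem hits_le_iff {x : ℕ → ℝ} {u : ℝ} {i m : ℕ} :
    hits x u i ≤ m ↔ ∑ j ∈ Finset.range i, x j - u ≤ m := Nat.ceil_le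

/-- The points have spacing `1`, so an interval of length at most `1` contains at most one of them.
This lets a program without rounding maintain the ceiling as a counter. -/
theorem hits_succ {x : ℕ → ℝ} {u : ℝ} {i : ℕ} (h0 : 0 ≤ x i) (h1 : x i ≤ 1) :
    hits x u (i + 1) = hits x u i + if hits x u i < hits x u (i + 1) then 1 else 0 := by
  have h2 : hits x u i ≤ hits x u (i + 1) := by
    apply Nat.ceil_le_ceil
    rw [Finset.sum_range_succ]; linarith
  have h3 : hits x u (i + 1) ≤ hits x u i + 1 := by
    have := hits_le_iff.1 (le_refl (hits x u i))
    rw [hits_le_iff, Finset.sum_range_succ]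
    push_cast
    linarith
  split_ifs <;> omega

theorem hits_last {x : ℕ → ℝ} {n ℓ : ℕ} {u : ℝ} (hx : ∑ j ∈ Finset.range n, x j = ℓ)
    (hu0 : 0 ≤ u) (hu1 : u < 1) : hits x u n = ℓ := by
  apply le_antisymm
  · rw [hits_le_iff, hx]; linarith
  · rcases ℓ with _ | k
    · exact Nat.zero_le _
    · have : k < hits x u n := by
        rw [lt_hits_iff, hx]; push_cast; linarith
      omega

theorem card_systematic {x : ℕ → ℝ} {n ℓ : ℕ} {u : ℝ} (h0 : ∀ i, 0 ≤ x i) (h1 : ∀ i, x i ≤ 1)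
    (hx : ∑ j ∈ Finset.range n, x j = ℓ) (hu0 : 0 ≤ u) (hu1 : u < 1) :
    (systematic n x u).card = ℓ := by
  have key : ∀ m, ∑ i ∈ Finset.range m, (if hits x u i < hits x u (i + 1) then 1 else 0)
      = hits x u m := by
    intro m
    induction m with
    | zero => simp [hits_zero hu0]
    | succ m ih => rw [Finset.sum_range_succ, ih, ← hits_succ (h0 m) (h1 m)]
  rw [systematic, Finset.card_filter, ← hits_last hx hu0 hu1, ← key n,
    ← Fin.sum_univ_eq_sum_range (fun i => if hits x u i < hits x u (i + 1) then 1 else 0)]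

/-- The sample determines how many points lie below each partial sum. -/
theorem hits_eq_of_systematic_eq {x : ℕ → ℝ} {n : ℕ} {u u' : ℝ} (h0 : ∀ i, 0 ≤ x i)
    (h1 : ∀ i, x i ≤ 1) (hu : 0 ≤ u) (hu' : 0 ≤ u') (h : systematic n x u = systematic n x u')
    {i : ℕ} (hi : i ≤ n) : hits x u i = hits x u' i := by
  induction i with
  | zero => rw [hits_zero hu, hits_zero hu']
  | succ i ih =>
    have h2 := Finset.ext_iff.1 h ⟨i, hi⟩
    simp only [systematic, Finset.mem_filter, Finset.mem_univ, true_and] at h2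
    rw [hits_succ (h0 i) (h1 i), hits_succ (u := u') (h0 i) (h1 i), ih (by omega)]
    rw [ih (by omega)] at h2
    simp only [h2]

theorem measurable_hits (x : ℕ → ℝ) (i : ℕ) : Measurable fun u => hits x u i :=
  Nat.measurable_ceil.comp (measurable_const.sub measurable_id)

theorem measurableSet_systematic (n : ℕ) (x : ℕ → ℝ) (S : Finset (Fin n)) :
    MeasurableSet (systematic n x ⁻¹' {S}) := by
  have : systematic n x ⁻¹' {S} = ⋂ i : Fin n, {u | hits x u i < hits x u (i + 1) ↔ i ∈ S} := by
    ext u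
    simp [systematic, Finset.ext_iff]
  rw [this]
  refine MeasurableSet.iInter fun i => ?_
  have h2 : MeasurableSet {u | hits x u i < hits x u (i + 1)} :=
    measurableSet_lt (measurable_hits x i) (measurable_hits x (i + 1))
  by_cases hi : i ∈ S
  · simpa [hi] using h2
  · simp only [hi, iff_false]
    exact h2.compl

instance : IsProbabilityMeasure unitLaw := ⟨by simp [unitLaw]⟩

/-- On `[0, 1)` the ceiling takes only two consecutive values and jumps at the fractional part of
`c`. Its mean is therefore the integer part plus the fractional part, that is `c`. -/
theorem ceil_sub_eq {c u : ℝ} (hc : 0 ≤ c) (hu : u ∈ Ico (0 : ℝ) 1) :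
    (⌈c - u⌉₊ : ℝ) = ⌊c⌋₊ + (Iio (c - ⌊c⌋₊)).indicator 1 u := by
  have h1 := Nat.floor_le hc
  have h2 := Nat.lt_floor_add_one c
  obtain ⟨hu0, hu1⟩ := hu
  by_cases h : u < c - ⌊c⌋₊
  · have : ⌈c - u⌉₊ = ⌊c⌋₊ + 1 := by
      rw [Nat.ceil_eq_iff (by omega)]
      simp only [Nat.add_sub_cancel]
      push_cast
      constructor <;> linarith
    rw [this, indicator_of_mem (by exact h)]
    simp
  · have : ⌈c - u⌉₊ = ⌊c⌋₊ := by
      push Not at h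
      apply le_antisymm
      · rw [Nat.ceil_le]; linarith
      · by_contra! h3
        have h4 : ⌈c - u⌉₊ + 1 ≤ ⌊c⌋₊ := h3
        have h5 := Nat.le_ceil (c - u)
        have h6 : ((⌈c - u⌉₊ + 1 : ℕ) : ℝ) ≤ ⌊c⌋₊ := by exact_mod_cast h4
        push_cast at h6
        linarith
    rw [this, indicator_of_notMem (by exact h)]
    simp

theorem integrable_indicator_unitLaw (a : ℝ) :
    Integrable ((Iio a).indicator (1 : ℝ → ℝ)) unitLaw :=
  (integrable_const (1 : ℝ)).indicator measurableSet_Iio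

theorem unitLaw_ae_mem : ∀ᵐ u ∂unitLaw, u ∈ Ico (0 : ℝ) 1 :=
  ae_restrict_mem measurableSet_Ico

theorem ceil_sub_ae_eq {c : ℝ} (hc : 0 ≤ c) : (fun u => (⌈c - u⌉₊ : ℝ)) =ᵐ[unitLaw]
    fun u => (⌊c⌋₊ : ℝ) + (Iio (c - ⌊c⌋₊)).indicator 1 u := by
  filter_upwards [unitLaw_ae_mem] with u hu using ceil_sub_eq hc hu

theorem integrable_ceil_sub {c : ℝ} (hc : 0 ≤ c) :
    Integrable (fun u => (⌈c - u⌉₊ : ℝ)) unitLaw :=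
  ((integrable_const _).add (integrable_indicator_unitLaw _)).congr (ceil_sub_ae_eq hc).symm

theorem integral_ceil_sub {c : ℝ} (hc : 0 ≤ c) : ∫ u, (⌈c - u⌉₊ : ℝ) ∂unitLaw = c := by
  have h1 := Nat.floor_le hc
  have h2 := Nat.lt_floor_add_one c
  rw [integral_congr_ae (ceil_sub_ae_eq hc), integral_add (integrable_const _)
    (integrable_indicator_unitLaw _), integral_indicator_one measurableSet_Iio]
  have h3 : unitLaw.real (Iio (c - ⌊c⌋₊)) = c - ⌊c⌋₊ := by
    have : Iio (c - ⌊c⌋₊) ∩ Ico 0 1 = Ico (0 : ℝ) (c - ⌊c⌋₊) := by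
      ext u; simp only [mem_inter_iff, mem_Iio, mem_Ico]
      constructor
      · rintro ⟨a, b, _⟩; exact ⟨b, a⟩
      · rintro ⟨a, b⟩; exact ⟨b, a, by linarith⟩
    rw [unitLaw, measureReal_restrict_apply measurableSet_Iio, this, Real.volume_real_Ico_of_le]
    · simp
    · linarith
  rw [h3]
  simp

/-! ### Inclusion probabilities of the systematic sample -/

section marginals

variable {x : ℕ → ℝ} {n ℓ : ℕ}

/-- The indicator of selecting box `i` is the difference of two consecutive counts, whose means are
the corresponding partial sums of `x`. -/
theorem unitLaw_selected (h0 : ∀ i, 0 ≤ x i) (h1 : ∀ i, x i ≤ 1) (i : Fin n) :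
    unitLaw.real {u | i ∈ systematic n x u} = x i := by
  have hm : MeasurableSet {u | i ∈ systematic n x u} := by
    have : {u | i ∈ systematic n x u} = {u | hits x u i < hits x u (i + 1)} := by
      ext u; simp [systematic]
    rw [this]
    exact measurableSet_lt (measurable_hits x i) (measurable_hits x (i + 1))
  have hc : ∀ k, 0 ≤ ∑ j ∈ Finset.range k, x j := fun k => Finset.sum_nonneg fun j _ => h0 j
  have e : {u | i ∈ systematic n x u}.indicator (1 : ℝ → ℝ) = fun u =>
      (⌈∑ j ∈ Finset.range (i + 1), x j - u⌉₊ : ℝ) - (⌈∑ j ∈ Finset.range i, x j - u⌉₊ : ℝ) := by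
    ext u
    change _ = (hits x u (i + 1) : ℝ) - hits x u i
    rw [hits_succ (h0 i) (h1 i)]
    by_cases h : hits x u i < hits x u (i + 1) <;> simp [systematic, h]
  rw [← integral_indicator_one hm, e, integral_sub (integrable_ceil_sub (hc _))
    (integrable_ceil_sub (hc _)), integral_ceil_sub (hc _), integral_ceil_sub (hc _),
    Finset.sum_range_succ]
  ring

/-- Almost every starting point gives exactly `ℓ` boxes, so restricting to `ℓ`-sets loses no mass,
and events can be evaluated on the starting point. -/
theorem sum_systematicLaw (h0 : ∀ i, 0 ≤ x i) (h1 : ∀ i, x i ≤ 1)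
    (hx : ∑ j ∈ Finset.range n, x j = ℓ) (P : Finset (Fin n) → Prop) [DecidablePred P] :
    ∑ S : Subsets n ℓ, (if P S.1 then systematicLaw n ℓ x S else 0)
      = unitLaw.real {u | P (systematic n x u)} := by
  have e1 : ∑ S : Subsets n ℓ, (if P S.1 then systematicLaw n ℓ x S else 0)
      = ∑ S ∈ Finset.univ.filter (fun S : Finset (Fin n) => S.card = ℓ ∧ P S),
        unitLaw.real (systematic n x ⁻¹' {S}) := by
    rw [← Finset.filter_filter, Finset.sum_filter]
    exact (Finset.sum_subtype (Finset.univ.filter fun S : Finset (Fin n) => S.card = ℓ)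
      (by simp) (fun S => if P S then unitLaw.real (systematic n x ⁻¹' {S}) else 0)).symm
  rw [e1, sum_measureReal_preimage_singleton _ fun S _ => measurableSet_systematic n x S]
  apply measureReal_congr
  filter_upwards [unitLaw_ae_mem] with u hu
  apply propext
  change systematic n x u ∈ (_ : Set (Finset (Fin n))) ↔ P (systematic n x u)
  simp [card_systematic h0 h1 hx hu.1 hu.2]

theorem systematicLaw_mem_stdSimplex (h0 : ∀ i, 0 ≤ x i) (h1 : ∀ i, x i ≤ 1)
    (hx : ∑ j ∈ Finset.range n, x j = ℓ) :
    systematicLaw n ℓ x ∈ stdSimplex ℝ (Subsets n ℓ) := by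
  refine ⟨fun S => measureReal_nonneg, ?_⟩
  have := sum_systematicLaw h0 h1 hx (fun _ => True)
  simpa using this

/-- The probability that box `i` is opened. -/
noncomputable def marginal (p : Subsets n ℓ → ℝ) (i : Fin n) : ℝ :=
  ∑ S : Subsets n ℓ, if i ∈ S.1 then p S else 0

theorem marginal_systematicLaw (h0 : ∀ i, 0 ≤ x i) (h1 : ∀ i, x i ≤ 1)
    (hx : ∑ j ∈ Finset.range n, x j = ℓ) (i : Fin n) :
    marginal (systematicLaw n ℓ x) i = x i := by
  rw [marginal, sum_systematicLaw h0 h1 hx (fun S => i ∈ S), unitLaw_selected h0 h1]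

end marginals

/-! ## A certificate of optimality -/

section certificate

variable {n ℓ t : ℕ} {v : Fin n → ℝ}

theorem expectedPay_eq_sum_marginal (v : Fin n → ℝ) (p : Subsets n ℓ → ℝ)
    (B : Finset (Fin n)) :
    expectedPay v p B = ∑ i, (if i ∈ B then 0 else v i) * marginal p i := by
  simp only [expectedPay, pay, marginal, Finset.mul_sum]
  rw [Finset.sum_comm]
  refine Finset.sum_congr rfl fun S _ => ?_
  rw [← Finset.sum_filter_add_sum_filter_not Finset.univ (fun i => i ∈ S.1)]
  rw [Finset.sum_congr rfl (g := fun _ => (0 : ℝ)) (s₁ := Finset.univ.filter fun i => i ∉ S.1)]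
  · simp only [Finset.sum_const_zero, add_zero, Finset.filter_univ_mem]
    refine Finset.sum_congr rfl fun i hi => ?_
    rw [if_pos hi, mul_comm]
  · intro i hi
    rw [if_neg (show i ∉ S.1 by simpa using hi), mul_zero]

theorem marginal_nonneg {p : Subsets n ℓ → ℝ} (hp : p ∈ stdSimplex ℝ (Subsets n ℓ)) (i : Fin n) :
    0 ≤ marginal p i :=
  Finset.sum_nonneg fun S _ => by split_ifs; exacts [hp.1 S, le_rfl]

theorem marginal_le_one {p : Subsets n ℓ → ℝ} (hp : p ∈ stdSimplex ℝ (Subsets n ℓ)) (i : Fin n) :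
    marginal p i ≤ 1 := by
  rw [← hp.2]
  exact Finset.sum_le_sum fun S _ => by split_ifs; exacts [le_rfl, hp.1 S]

theorem sum_marginal {p : Subsets n ℓ → ℝ} (hp : p ∈ stdSimplex ℝ (Subsets n ℓ)) :
    ∑ i, marginal p i = ℓ := by
  simp only [marginal]
  rw [Finset.sum_comm]
  have : ∀ S : Subsets n ℓ, ∑ i, (if i ∈ S.1 then p S else 0) = ℓ * p S := by
    intro S
    rw [← Finset.sum_filter, Finset.filter_univ_mem, Finset.sum_const, S.2, nsmul_eq_mul]
  simp only [this]
  rw [← Finset.mul_sum, hp.2, mul_one]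

theorem val_le_expectedPay (v : Fin n → ℝ) (p : Subsets n ℓ → ℝ) (B : Subsets n t) :
    val v t p ≤ expectedPay v p B.1 :=
  ciInf_le (Set.finite_range _).bddBelow B

/-- Averaging over a random set of empty boxes bounds the worst case from above. -/
theorem val_le_sum {p : Subsets n ℓ → ℝ} {w : ℕ → ℝ} (hw0 : ∀ i, 0 ≤ w i) (hw1 : ∀ i, w i ≤ 1)
    (hw : ∑ i ∈ Finset.range n, w i = n - t) :
    val v t p ≤ ∑ i : Fin n, w i * (v i * marginal p i) := by
  have b0 : ∀ i, 0 ≤ 1 - w i := fun i => sub_nonneg.2 (hw1 i)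
  have b1 : ∀ i, 1 - w i ≤ 1 := fun i => by linarith [hw0 i]
  have hb : ∑ i ∈ Finset.range n, (1 - w i) = t := by
    rw [Finset.sum_sub_distrib, hw]; simp
  -- Systematic sampling is used for the adversary as well: it realizes the emptiness probabilities
  -- `1 - w i` by a random `t`-set.
  have hq := systematicLaw_mem_stdSimplex b0 b1 hb
  have hm := marginal_systematicLaw b0 b1 hb
  set q := systematicLaw n t (fun i => 1 - w i)
  calc val v t p = ∑ B, q B * val v t p := by rw [← Finset.sum_mul, hq.2, one_mul]
    _ ≤ ∑ B, q B * expectedPay v p B.1 :=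
      Finset.sum_le_sum fun B _ => mul_le_mul_of_nonneg_left (val_le_expectedPay v p B) (hq.1 B)
    _ = ∑ i : Fin n, w i * (v i * marginal p i) := by
      simp only [expectedPay_eq_sum_marginal, Finset.mul_sum]
      rw [Finset.sum_comm]
      refine Finset.sum_congr rfl fun i _ => ?_
      have h1 : ∀ B : Subsets n t, q B * ((if i ∈ B.1 then 0 else v i) * marginal p i)
          = (q B - if i ∈ B.1 then q B else 0) * (v i * marginal p i) := by
        intro B; split_ifs <;> ring
      simp only [h1]
      rw [← Finset.sum_mul, Finset.sum_sub_distrib, hq.2]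
      have h2 := hm i
      rw [marginal] at h2
      rw [h2]
      ring

/-- The conditions with `lam` make `x` a best response to `w`; those with `tau` make `w` a best
response to `x`. The payoff of the pair then bounds every `val v t q` from above and every payoff of
`x` from below. -/
theorem isOptimal_of_certificate (ht : t ≤ n) {x w : ℕ → ℝ} {lam tau : ℝ}
    (h0 : ∀ i, 0 ≤ x i) (h1 : ∀ i, x i ≤ 1) (hx : ∑ i ∈ Finset.range n, x i = ℓ)
    (hw0 : ∀ i, 0 ≤ w i) (hw1 : ∀ i, w i ≤ 1) (hw : ∑ i ∈ Finset.range n, w i = n - t)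
    (hlow : ∀ i : Fin n, 0 < x i → lam ≤ w i * v i)
    (hhigh : ∀ i : Fin n, x i < 1 → w i * v i ≤ lam)
    (hpay : ∀ i : Fin n, 0 < w i → v i * x i ≤ tau)
    (hpay' : ∀ i : Fin n, w i < 1 → tau ≤ v i * x i) :
    IsOptimal v t (systematicLaw n ℓ x) := by
  refine ⟨systematicLaw_mem_stdSimplex h0 h1 hx, isMaxOn_iff.2 fun q hq => ?_⟩
  have hm := marginal_systematicLaw h0 h1 hx
  have hfx : ∑ i : Fin n, x i = ℓ := by rw [Fin.sum_univ_eq_sum_range x, hx]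
  have hfw : ∑ i : Fin n, w i = n - t := by rw [Fin.sum_univ_eq_sum_range w, hw]
  have step1 : ∑ i : Fin n, w i * (v i * marginal q i) ≤ ∑ i : Fin n, w i * (v i * x i) := by
    -- A nonzero first factor forces `x i` to be `0` or `1`, on the side that makes the product
    -- nonnegative. Both marginal vectors sum to `ℓ`, so `lam` cancels.
    have : 0 ≤ ∑ i : Fin n, (w i * v i - lam) * (x i - marginal q i) := by
      refine Finset.sum_nonneg fun i _ => ?_
      have hq0 := marginal_nonneg hq i
      have hq1 := marginal_le_one hq i
      rcases lt_trichotomy (w i * v i) lam with h | h | h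
      · have : x i = 0 := le_antisymm (not_lt.1 fun hp => absurd (hlow i hp) (not_le.2 h)) (h0 i)
        rw [this]
        nlinarith
      · simp [h]
      · have : x i = 1 := le_antisymm (h1 i) (not_lt.1 fun hp => absurd (hhigh i hp) (not_le.2 h))
        rw [this]
        exact mul_nonneg (by linarith) (by linarith)
    have e : ∑ i : Fin n, (w i * v i - lam) * (x i - marginal q i)
        = ∑ i : Fin n, w i * (v i * x i) - ∑ i : Fin n, w i * (v i * marginal q i)
          - lam * (∑ i : Fin n, x i - ∑ i, marginal q i) := by
      rw [← Finset.sum_sub_distrib, ← Finset.sum_sub_distrib, Finset.mul_sum,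
        ← Finset.sum_sub_distrib]
      exact Finset.sum_congr rfl fun i _ => by ring
    rw [e, hfx, sum_marginal hq] at this
    linarith
  have : Nonempty (Subsets n t) := by
    obtain ⟨B, -, hB⟩ := Finset.exists_subset_card_eq (s := (Finset.univ : Finset (Fin n)))
      (n := t) (by simpa using ht)
    exact ⟨⟨B, hB⟩⟩
  refine (val_le_sum hw0 hw1 hw).trans (step1.trans (le_ciInf fun B => ?_))
  rw [expectedPay_eq_sum_marginal]
  simp only [hm]
  -- The same exchange argument for the adversary: the indicator of the complement of `B` and `w`
  -- both sum to `n - t`, so `tau` cancels.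
  have : 0 ≤ ∑ i : Fin n, ((if i ∈ B.1 then 0 else 1) - w i) * (v i * x i - tau) := by
    refine Finset.sum_nonneg fun i _ => ?_
    split_ifs
    · rcases (hw0 i).eq_or_lt with h | h
      · simp [← h]
      · have := hpay i h
        nlinarith
    · rcases (hw1 i).eq_or_lt with h | h
      · simp [h]
      · have := hpay' i h
        nlinarith
  have hB : ∑ i : Fin n, (if i ∈ B.1 then (0 : ℝ) else 1) = n - t := by
    have : ∀ i : Fin n, (if i ∈ B.1 then (0 : ℝ) else 1) = 1 - if i ∈ B.1 then 1 else 0 := by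
      intro i; split_ifs <;> simp
    simp only [this]
    rw [Finset.sum_sub_distrib, ← Finset.sum_filter, Finset.filter_univ_mem]
    simp [B.2]
  have e : ∑ i : Fin n, ((if i ∈ B.1 then 0 else 1) - w i) * (v i * x i - tau)
      = ∑ i : Fin n, (if i ∈ B.1 then 0 else v i) * x i - ∑ i : Fin n, w i * (v i * x i)
        - tau * (∑ i : Fin n, (if i ∈ B.1 then (0 : ℝ) else 1) - ∑ i : Fin n, w i) := by
    rw [← Finset.sum_sub_distrib, ← Finset.sum_sub_distrib, Finset.mul_sum,
      ← Finset.sum_sub_distrib]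
    exact Finset.sum_congr rfl fun i _ => by split_ifs <;> ring
  rw [e, hB, hfw] at this
  linarith

end certificate

/-! ## Threshold solutions -/

section threshold

/-- Sum of the reciprocals of the first `r` values. -/
noncomputable def invSum (V : ℕ → ℝ) (r : ℕ) : ℝ := ∑ i ∈ Finset.range r, 1 / V i

/-- Opening probabilities of a threshold solution: the first `r` boxes contribute `tau` each, the
boxes `r, …, k - 1` are opened for sure, and box `k` is opened with probability `e`. -/
noncomputable def threshold (V : ℕ → ℝ) (r k : ℕ) (tau e : ℝ) (i : ℕ) : ℝ :=
  if i < r then tau / V i else if i < k then 1 else if i < k + 1 then e else 0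

/-- A sequence of values of `n` boxes in decreasing order, continued by zeros. -/
structure IsValues (V : ℕ → ℝ) (n : ℕ) : Prop where
  anti : Antitone V
  pos : ∀ i < n, 0 < V i
  zero : ∀ i, n ≤ i → V i = 0

/-- Invariant of the search for the threshold. -/
structure SearchInv (V : ℕ → ℝ) (n ℓ r k : ℕ) : Prop where
  one_le : 1 ≤ r
  r_le : r ≤ k
  k_le : k ≤ n
  -- The mass left for box `k` is at least `0` at `tau = V r` and at most `1` at `tau = V (r - 1)`.
  lower : r < k → V r * invSum V r + k - r ≤ ℓ
  upper : (ℓ : ℝ) ≤ V (r - 1) * invSum V r + k + 1 - r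

/-- The threshold `tau` is the breakpoint at which the search entered the pair `(r, k)`, coming
from a pair at which a smaller threshold was preferable. -/
structure IsBreakpoint (V : ℕ → ℝ) (n t ℓ r k : ℕ) (tau : ℝ) : Prop where
  pos : 0 < tau
  le_value : tau ≤ V (r - 1)
  value_le : r < k → V r ≤ tau
  mass_le : tau * invSum V r + k - r ≤ ℓ
  le_mass : (ℓ : ℝ) ≤ tau * invSum V r + k - r + 1
  -- The strict inequalities are the slope condition at the previous pair. That pair is `(r - 1, k)`
  -- in the first case, and `(r, k - 1)` or `(r - 1, k - 1)` in the second; for the last one,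
  -- passing to `invSum V r` adds `1` to both sides.
  entered : (tau = V (r - 1) ∧ k < n ∧ (r : ℝ) - 1 - t < V k * invSum V (r - 1)) ∨
    (tau * invSum V r + k - r = ℓ ∧ (r : ℝ) - t < V (k - 1) * invSum V r)

variable {V : ℕ → ℝ} {n t ℓ r k : ℕ} {tau e : ℝ}

/-! ### Reciprocal sums and the events of the search -/

theorem invSum_succ (V : ℕ → ℝ) (r : ℕ) : invSum V (r + 1) = invSum V r + 1 / V r :=
  Finset.sum_range_succ _ _

theorem IsValues.nonneg (hV : IsValues V n) (i : ℕ) : 0 ≤ V i := by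
  by_cases h : i < n
  · exact (hV.pos i h).le
  · exact (hV.zero i (by omega)).ge

theorem IsValues.invSum_nonneg (hV : IsValues V n) (r : ℕ) : 0 ≤ invSum V r :=
  Finset.sum_nonneg fun i _ => one_div_nonneg.2 (hV.nonneg i)

theorem IsValues.invSum_pos (hV : IsValues V n) (h1 : 1 ≤ r) (hn : r ≤ n) : 0 < invSum V r := by
  obtain ⟨s, rfl⟩ := Nat.exists_eq_add_of_le' h1
  rw [invSum_succ]
  exact add_pos_of_nonneg_of_pos (hV.invSum_nonneg s) (one_div_pos.2 (hV.pos s (by omega)))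

theorem IsValues.mul_invSum_succ (hV : IsValues V n) (h : r < n) :
    V r * invSum V (r + 1) = V r * invSum V r + 1 := by
  rw [invSum_succ, mul_add, mul_one_div_cancel (hV.pos r h).ne']

theorem SearchInv.init (hV : IsValues V n) (hℓ : 1 ≤ ℓ) (hn : ℓ < n) : SearchInv V n ℓ 1 ℓ := by
  have h0 : 0 < V 0 := hV.pos 0 (by omega)
  have e1 : invSum V 1 = 1 / V 0 := by simp [invSum]
  refine ⟨le_rfl, hℓ, hn.le, fun _ => ?_, ?_⟩
  · have : V 1 * (1 / V 0) ≤ 1 := by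
      rw [mul_one_div, div_le_one h0]; exact hV.anti (Nat.zero_le 1)
    rw [e1]
    push_cast
    linarith
  · have : V (1 - 1) * (1 / V 0) = 1 := mul_one_div_cancel h0.ne'
    rw [e1, this]
    push_cast
    linarith

/-- The search always makes a move, since it starts with `r = 1 ≤ t`. Hence the threshold at which
it stops is a breakpoint. -/
theorem search_init (hV : IsValues V n) (hn : ℓ < n) (ht : 1 ≤ t) :
    ((1 : ℕ) : ℝ) < t + V ℓ * (1 / V 0) := by
  have h0 : 0 < V 0 := hV.pos 0 (by omega)
  have : 0 < V ℓ * (1 / V 0) := mul_pos (hV.pos ℓ hn) (one_div_pos.2 h0)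
  have : (1 : ℝ) ≤ t := by exact_mod_cast ht
  push_cast
  linarith

/-- The next event is that box `r` is no longer opened for sure. -/
theorem SearchInv.lower_level (hV : IsValues V n) (h : SearchInv V n ℓ r k) (hk : k < n)
    (hs : (r : ℝ) < t + V k * invSum V r) (hc : (ℓ : ℝ) < V r * invSum V r + (k + 1 - r))
    (hr : r < k) : SearchInv V n ℓ (r + 1) k ∧ IsBreakpoint V n t ℓ (r + 1) k (V r) := by
  have e1 := hV.mul_invSum_succ (hr.trans hk)
  have hl := h.lower hr
  have hanti : V (r + 1) ≤ V r := hV.anti (Nat.le_succ r)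
  refine ⟨⟨by omega, hr, hk.le, fun _ => ?_, ?_⟩, hV.pos r (hr.trans hk), le_rfl, fun _ => hanti,
    ?_, ?_, Or.inl ⟨rfl, hk, ?_⟩⟩
  · have := mul_le_mul_of_nonneg_right hanti (hV.invSum_nonneg (r + 1))
    push_cast; linarith
  · rw [Nat.add_sub_cancel]; push_cast; linarith
  · push_cast; linarith
  · push_cast; linarith
  · rw [Nat.add_sub_cancel]; push_cast; linarith

/-- The next event is that box `k = r` reaches the level of the boxes before it. -/
theorem searchInv_extend_level (hV : IsValues V n) (hk : r < n)
    (hℓ : 1 ≤ ℓ) (hs : (r : ℝ) < t + V r * invSum V r)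
    (hc : (ℓ : ℝ) < V r * invSum V r + (r + 1 - r)) :
    SearchInv V n ℓ (r + 1) (r + 1) ∧
      IsBreakpoint V n t ℓ (r + 1) (r + 1) (ℓ / invSum V (r + 1)) := by
  have e1 := hV.mul_invSum_succ hk
  have hpos := hV.invSum_pos (r := r + 1) (by omega) hk
  have hℓ' : (0 : ℝ) < ℓ := by exact_mod_cast hℓ
  -- With `r + 1` boxes on a common level and no other box opened, total mass `ℓ` forces this value
  -- of `tau`.
  have e2 : ℓ / invSum V (r + 1) * invSum V (r + 1) = ℓ := div_mul_cancel₀ _ hpos.ne'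
  refine ⟨⟨by omega, le_rfl, hk, fun h => absurd h (lt_irrefl _), ?_⟩, div_pos hℓ' hpos, ?_,
    fun h => absurd h (lt_irrefl _), ?_, ?_, Or.inr ⟨?_, ?_⟩⟩
  · rw [Nat.add_sub_cancel]; push_cast; linarith
  · rw [Nat.add_sub_cancel, div_le_iff₀ hpos]; linarith
  · rw [e2]; linarith
  · rw [e2]; linarith
  · rw [e2]; ring
  · rw [Nat.add_sub_cancel]; push_cast; linarith

/-- The next event is that box `k` is opened for sure. -/
theorem SearchInv.fill (hV : IsValues V n) (h : SearchInv V n ℓ r k) (hk : k < n)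
    (hs : (r : ℝ) < t + V k * invSum V r) (hc : ¬ (ℓ : ℝ) < V r * invSum V r + (k + 1 - r)) :
    SearchInv V n ℓ r (k + 1) ∧
      IsBreakpoint V n t ℓ r (k + 1) ((ℓ - (k + 1 - r)) / invSum V r) := by
  have hpos := hV.invSum_pos h.one_le (h.r_le.trans hk.le)
  -- At this `tau` the mass of box `k` is exactly `1`.
  have e2 : (ℓ - (k + 1 - r)) / invSum V r * invSum V r = ℓ - (k + 1 - r) :=
    div_mul_cancel₀ _ hpos.ne'
  have hVr : 0 < V r := hV.pos r (h.r_le.trans_lt hk)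
  have hu := h.upper
  have hp : 0 < V r * invSum V r := mul_pos hVr hpos
  refine ⟨⟨h.one_le, h.r_le.trans (Nat.le_succ k), hk, fun _ => ?_, ?_⟩, div_pos ?_ hpos, ?_,
    fun _ => ?_, ?_, ?_, Or.inr ⟨?_, ?_⟩⟩
  · push_cast; linarith
  · push_cast; linarith
  · linarith
  · rw [div_le_iff₀ hpos]; linarith
  · rw [le_div_iff₀ hpos]; linarith
  · rw [e2]; push_cast; linarith
  · rw [e2]; push_cast; linarith
  · rw [e2]; push_cast; linarith
  · rw [Nat.add_sub_cancel]; linarith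

/-! ### Mass and range of threshold vectors -/

theorem sum_threshold_of_le (hr : r ≤ k) : ∀ m, k + 1 ≤ m →
    ∑ i ∈ Finset.range m, threshold V r k tau e i = tau * invSum V r + (k - r) + e := by
  have h1 : ∑ i ∈ Finset.range r, threshold V r k tau e i = tau * invSum V r := by
    rw [invSum, Finset.mul_sum]
    refine Finset.sum_congr rfl fun i hi => ?_
    rw [threshold, if_pos (Finset.mem_range.1 hi), mul_one_div]
  have h2 : ∀ m, r ≤ m → m ≤ k →
      ∑ i ∈ Finset.range m, threshold V r k tau e i = tau * invSum V r + (m - r) := by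
    intro m hm
    induction m, hm using Nat.le_induction with
    | base => intro _; rw [h1]; ring
    | succ m hm ih =>
      intro hk
      rw [Finset.sum_range_succ, ih (by omega), threshold, if_neg (by omega), if_pos (by omega)]
      push_cast; ring
  intro m hm
  induction m, hm using Nat.le_induction with
  | base =>
    rw [Finset.sum_range_succ, h2 k hr le_rfl, threshold, if_neg (by omega), if_neg (by omega),
      if_pos (by omega)]
  | succ m hm ih =>
    rw [Finset.sum_range_succ, ih, threshold, if_neg (by omega), if_neg (by omega),
      if_neg (by omega), add_zero]

theorem threshold_nonneg (hV : IsValues V n) (ht : 0 ≤ tau) (he : 0 ≤ e) (i : ℕ) :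
    0 ≤ threshold V r k tau e i := by
  unfold threshold
  split_ifs
  exacts [div_nonneg ht (hV.nonneg i), zero_le_one, he, le_rfl]

theorem threshold_le_one (hV : IsValues V n) (hr : r ≤ n) (ht : tau ≤ V (r - 1)) (he : e ≤ 1)
    (i : ℕ) : threshold V r k tau e i ≤ 1 := by
  unfold threshold
  split_ifs with h
  · rw [div_le_one (hV.pos i (by omega))]
    exact ht.trans (hV.anti (by omega))
  · exact le_rfl
  · exact he
  · exact zero_le_one

/-- The threshold solution at which the search stops. -/
noncomputable def searchResult (V : ℕ → ℝ) (ℓ r k : ℕ) (tau : ℝ) : ℕ → ℝ :=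
  threshold V r k tau (ℓ - tau * invSum V r - (k - r))

theorem searchResult_nonneg (hV : IsValues V n) (hb : IsBreakpoint V n t ℓ r k tau) (i : ℕ) :
    0 ≤ searchResult V ℓ r k tau i :=
  threshold_nonneg hV hb.pos.le (by linarith [hb.mass_le]) i

theorem searchResult_le_one (hV : IsValues V n) (h : SearchInv V n ℓ r k)
    (hb : IsBreakpoint V n t ℓ r k tau) (i : ℕ) : searchResult V ℓ r k tau i ≤ 1 :=
  threshold_le_one hV (h.r_le.trans h.k_le) hb.le_value (by linarith [hb.le_mass]) i

/-- For `k = n` there is no box to take the leftover mass, but such a pair is entered only by an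
event that leaves none. -/
theorem sum_searchResult (h : SearchInv V n ℓ r k) (hb : IsBreakpoint V n t ℓ r k tau) :
    ∑ i ∈ Finset.range n, searchResult V ℓ r k tau i = ℓ := by
  rcases h.k_le.lt_or_eq with hk | rfl
  · rw [searchResult, sum_threshold_of_le h.r_le n hk]; ring
  · have h1 := sum_threshold_of_le (V := V) (tau := tau) (e := ℓ - tau * invSum V r - (k - r))
      h.r_le (k + 1) le_rfl
    rw [Finset.sum_range_succ] at h1
    have h2 : threshold V r k tau (ℓ - tau * invSum V r - (k - r)) k
        = ℓ - tau * invSum V r - (k - r) := by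
      rw [threshold, if_neg (by have := h.r_le; omega), if_neg (by omega), if_pos (by omega)]
    rw [h2] at h1
    rcases hb.entered with ⟨-, h3, -⟩ | ⟨h3, -⟩
    · omega
    · rw [searchResult]; linarith

/-- Since `tau = V (r - 1)`, the last level box `s = r - 1` is also opened surely, so slackness
leaves `w s` free between `V k / V s` and `1`. The level `lam = V k` fixes the weights before `s`,
and the total `n - t` then forces `w s = θ`. -/
theorem isOptimal_of_entered_level (hV : IsValues V n) (ht : t < n) (h : SearchInv V n ℓ r k)
    (hb : IsBreakpoint V n t ℓ r k tau) (htau : tau = V (r - 1)) (hk : k < n)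
    (hs : (r : ℝ) - 1 - t < V k * invSum V (r - 1)) (hdone : t + V k * invSum V r ≤ r) :
    IsOptimal (fun i : Fin n => V i) t (systematicLaw n ℓ (searchResult V ℓ r k tau)) := by
  obtain ⟨s, rfl⟩ := Nat.exists_eq_add_of_le' h.one_le
  rw [Nat.add_sub_cancel] at htau hs
  have hsk : s < k := h.r_le
  have hVs : 0 < V s := hV.pos s (hsk.trans hk)
  have hVk : 0 < V k := hV.pos k hk
  push_cast at hs hdone
  rw [invSum_succ, mul_add, mul_one_div] at hdone
  set θ : ℝ := s + 1 - t - V k * invSum V s with hθ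
  have hratio : 0 < V k / V s := div_pos hVk hVs
  -- The bounds on `θ` are the slope conditions after and before the breakpoint.
  have hθ0 : V k / V s ≤ θ := by linarith
  have hθ1 : θ ≤ 1 := by linarith
  have hx0 := searchResult_nonneg hV hb
  have hx1 := searchResult_le_one hV h hb
  have hxlt : ∀ i < s + 1, V i * searchResult V ℓ (s + 1) k tau i = tau := by
    intro i hi
    rw [searchResult, threshold, if_pos hi]
    exact mul_div_cancel₀ _ (hV.pos i (by omega)).ne'
  refine isOptimal_of_certificate (lam := V k) (tau := tau)
    (w := fun i => if i < s then V k / V i else if i < s + 1 then θ else 1)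
    ht.le hx0 hx1 (sum_searchResult h hb) ?_ ?_ ?_ ?_ ?_ ?_ ?_
  · intro i
    split_ifs
    exacts [div_nonneg hVk.le (hV.nonneg i), by linarith, zero_le_one]
  · intro i
    split_ifs with h1
    · rw [div_le_one (hV.pos i (by omega))]; exact hV.anti (by omega)
    · exact hθ1
    · exact le_rfl
  · have key : ∀ m, s + 1 ≤ m → ∑ i ∈ Finset.range m,
        (if i < s then V k / V i else if i < s + 1 then θ else 1) = m - t := by
      intro m hm
      induction m, hm using Nat.le_induction with
      | base =>
        have : ∑ i ∈ Finset.range s, (if i < s then V k / V i else if i < s + 1 then θ else 1)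
            = V k * invSum V s := by
          rw [invSum, Finset.mul_sum]
          refine Finset.sum_congr rfl fun i hi => ?_
          rw [if_pos (Finset.mem_range.1 hi), mul_one_div]
        rw [Finset.sum_range_succ, this, if_neg (by omega), if_pos (by omega)]
        push_cast; linarith
      | succ m hm ih =>
        rw [Finset.sum_range_succ, ih, if_neg (by omega), if_neg (by omega)]
        push_cast; ring
    exact key n (by omega)
  · intro i hi
    split_ifs with h1 h2
    · rw [div_mul_cancel₀ _ (hV.pos i i.2).ne']
    · have : (i : ℕ) = s := by omega
      rw [this]
      exact (div_le_iff₀ hVs).1 hθ0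
    · rw [one_mul]
      refine hV.anti (not_lt.1 fun h3 => ?_)
      rw [searchResult, threshold, if_neg h2, if_neg (by omega), if_neg (by omega)] at hi
      exact lt_irrefl _ hi
  · intro i hi
    split_ifs with h1 h2
    · rw [div_mul_cancel₀ _ (hV.pos i i.2).ne']
    · have : (i : ℕ) = s := by omega
      rw [this, searchResult, threshold, if_pos (by omega), htau, div_self hVs.ne'] at hi
      exact absurd hi (lt_irrefl _)
    · rw [one_mul]
      refine hV.anti (not_lt.1 fun h3 => ?_)
      rw [searchResult, threshold, if_neg h2, if_pos h3] at hi
      exact lt_irrefl _ hi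
  · intro i _
    by_cases h1 : (i : ℕ) < s + 1
    · exact (hxlt i h1).le
    · calc V i * _ ≤ V i * 1 := mul_le_mul_of_nonneg_left (hx1 i) (hV.nonneg i)
        _ ≤ tau := by rw [mul_one, htau]; exact hV.anti (by omega)
  · intro i hi
    by_cases h1 : (i : ℕ) < s + 1
    · exact (hxlt i h1).ge
    · rw [if_neg (by omega), if_neg h1] at hi
      exact absurd hi (lt_irrefl _)

theorem searchResult_of_mass_eq (hmass : tau * invSum V r + k - r = ℓ) :
    searchResult V ℓ r k tau
      = fun i => if i < r then tau / V i else if i < k then 1 else 0 := by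
  ext i
  have : (ℓ : ℝ) - tau * invSum V r - (k - r) = 0 := by linarith
  rw [searchResult, this, threshold]
  split_ifs <;> rfl

/-- Box `k` has no mass, so `lam` may be any value between `V k` and `V (k - 1)`. Weights `lam / V
i` on the first `r` boxes and `1` elsewhere have total `n - t` only for `lam = (r - t) / invSum V
r`; the two slope conditions place it in that range. -/
theorem isOptimal_of_entered_fill (hV : IsValues V n) (ht : t < n) (h : SearchInv V n ℓ r k)
    (hb : IsBreakpoint V n t ℓ r k tau) (hmass : tau * invSum V r + k - r = ℓ)
    (hs : (r : ℝ) - t < V (k - 1) * invSum V r) (hdone : t + V k * invSum V r ≤ r) :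
    IsOptimal (fun i : Fin n => V i) t (systematicLaw n ℓ (searchResult V ℓ r k tau)) := by
  have hrn : r ≤ n := h.r_le.trans h.k_le
  have hpos := hV.invSum_pos h.one_le hrn
  set lam : ℝ := (r - t) / invSum V r with hlam
  have hl1 : lam < V (k - 1) := by rw [hlam, div_lt_iff₀ hpos]; exact hs
  have hl2 : V k ≤ lam := by rw [hlam, le_div_iff₀ hpos]; linarith
  have hl0 : 0 ≤ lam := (hV.nonneg k).trans hl2
  have hx0 := searchResult_nonneg hV hb
  have hx1 := searchResult_le_one hV h hb
  have hsum := sum_searchResult h hb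
  rw [searchResult_of_mass_eq hmass] at hx0 hx1 hsum ⊢
  have hlow : ∀ i < k, lam ≤ V i := fun i hi => hl1.le.trans (hV.anti (by omega))
  refine isOptimal_of_certificate (lam := lam) (tau := tau)
    (w := fun i => if i < r then lam / V i else 1)
    ht.le hx0 hx1 hsum ?_ ?_ ?_ ?_ ?_ ?_ ?_
  · intro i
    split_ifs
    exacts [div_nonneg hl0 (hV.nonneg i), zero_le_one]
  · intro i
    split_ifs with h1
    · rw [div_le_one (hV.pos i (by omega))]
      exact hlow i (h1.trans_le h.r_le)
    · exact le_rfl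
  · have key : ∀ m, r ≤ m → ∑ i ∈ Finset.range m, (if i < r then lam / V i else 1) = m - t := by
      intro m hm
      induction m, hm using Nat.le_induction with
      | base =>
        have : ∑ i ∈ Finset.range r, (if i < r then lam / V i else 1) = lam * invSum V r := by
          rw [invSum, Finset.mul_sum]
          refine Finset.sum_congr rfl fun i hi => ?_
          rw [if_pos (Finset.mem_range.1 hi), mul_one_div]
        rw [this, hlam, div_mul_cancel₀ _ hpos.ne']
      | succ m hm ih =>
        rw [Finset.sum_range_succ, ih, if_neg (by omega)]
        push_cast; ring
    exact key n hrn
  · intro i hi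
    split_ifs at hi ⊢ with h1 h2
    · rw [div_mul_cancel₀ _ (hV.pos i i.2).ne']
    · rw [one_mul]; exact hlow i h2
    · exact absurd hi (lt_irrefl _)
  · intro i hi
    split_ifs at hi ⊢ with h1 h2
    · rw [div_mul_cancel₀ _ (hV.pos i i.2).ne']
    · exact absurd hi (lt_irrefl _)
    · rw [one_mul]; exact (hV.anti (by omega)).trans hl2
  · intro i _
    split_ifs with h1 h2
    · rw [mul_div_cancel₀ _ (hV.pos i i.2).ne']
    · rw [mul_one]; exact (hV.anti (by omega)).trans (hb.value_le (by omega))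
    · rw [mul_zero]; exact hb.pos.le
  · intro i hi
    split_ifs at hi with h1
    · rw [if_pos h1, mul_div_cancel₀ _ (hV.pos i i.2).ne']
    · exact absurd hi (lt_irrefl _)

/-- Boxes from `r` on are opened surely and `r < t`, so emptying the first `t` boxes is a worst case
and the certificate is deterministic. The level separating emptied from surviving boxes is `V t`,
not the threshold `tau`. -/
theorem isOptimal_of_all_filled (hV : IsValues V n) (ht : t < n) (h : SearchInv V n ℓ r n)
    (hb : IsBreakpoint V n t ℓ r n tau) (hmass : tau * invSum V r + n - r = ℓ) (hrt : r < t) :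
    IsOptimal (fun i : Fin n => V i) t (systematicLaw n ℓ (searchResult V ℓ r n tau)) := by
  have hx0 := searchResult_nonneg hV hb
  have hx1 := searchResult_le_one hV h hb
  have hsum := sum_searchResult h hb
  rw [searchResult_of_mass_eq hmass] at hx0 hx1 hsum ⊢
  refine isOptimal_of_certificate (lam := 0) (tau := V t) (w := fun i => if i < t then 0 else 1)
    ht.le hx0 hx1 hsum ?_ ?_ ?_ ?_ ?_ ?_ ?_
  · intro i
    split_ifs
    exacts [le_rfl, zero_le_one]
  · intro i
    split_ifs
    exacts [zero_le_one, le_rfl]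
  · have key : ∀ m, t ≤ m → ∑ i ∈ Finset.range m, (if i < t then (0 : ℝ) else 1) = m - t := by
      intro m hm
      induction m, hm using Nat.le_induction with
      | base =>
        rw [sub_self]
        exact Finset.sum_eq_zero fun i hi => if_pos (Finset.mem_range.1 hi)
      | succ m hm ih =>
        rw [Finset.sum_range_succ, ih, if_neg (by omega)]
        push_cast; ring
    exact key n ht.le
  · intro i _
    split_ifs
    · simp
    · rw [one_mul]; exact hV.nonneg i
  · intro i hi
    by_cases h1 : (i : ℕ) < t
    · rw [if_pos h1, zero_mul]
    · rw [if_neg (by omega), if_pos i.2] at hi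
      exact absurd hi (lt_irrefl _)
  · intro i hi
    split_ifs at hi with h1
    · exact absurd hi (lt_irrefl _)
    · rw [if_neg (by omega), if_pos i.2, mul_one]
      exact hV.anti (by omega)
  · intro i hi
    split_ifs at hi with h1
    · by_cases h2 : (i : ℕ) < r
      · rw [if_pos h2, mul_div_cancel₀ _ (hV.pos i i.2).ne']
        exact (hV.anti hrt.le).trans (hb.value_le (hrt.trans ht))
      · rw [if_neg h2, if_pos i.2, mul_one]; exact hV.anti h1.le
    · exact absurd hi (lt_irrefl _)

theorem isOptimal_searchResult (hV : IsValues V n) (ht : t < n) (h : SearchInv V n ℓ r k)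
    (hb : IsBreakpoint V n t ℓ r k tau) (hdone : ¬ (k < n ∧ (r : ℝ) < t + V k * invSum V r)) :
    IsOptimal (fun i : Fin n => V i) t (systematicLaw n ℓ (searchResult V ℓ r k tau)) := by
  rcases hb.entered with ⟨h1, h2, h3⟩ | ⟨h1, h2⟩
  · exact isOptimal_of_entered_level hV ht h hb h1 h2 h3 (not_lt.1 fun h4 => hdone ⟨h2, h4⟩)
  · by_cases h3 : t + V k * invSum V r ≤ r
    · exact isOptimal_of_entered_fill hV ht h hb h1 h2 h3
    · have h4 : ¬ k < n := fun h4 => hdone ⟨h4, not_le.1 h3⟩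
      obtain rfl : k = n := le_antisymm h.k_le (not_lt.1 h4)
      refine isOptimal_of_all_filled hV ht h hb h1 ?_
      -- The continuation `V n = 0` reduces the slope condition to `r < t`.
      rw [hV.zero k le_rfl, zero_mul, add_zero, Nat.cast_le] at h3
      exact not_le.1 h3

end threshold

/-! ## The intervals on which the systematic sample is constant -/

section intervals

/-- The largest `u' ≤ 1` such that the first `i` partial sums have the same number of points below
them for all starting points in `[u, u')`. -/
noncomputable def nextStart (x : ℕ → ℝ) (u : ℝ) : ℕ → ℝ
  | 0 => 1
  | i + 1 =>
    if 0 < hits x u (i + 1) ∧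
        ∑ j ∈ Finset.range (i + 1), x j + 1 - hits x u (i + 1) < nextStart x u i
    then ∑ j ∈ Finset.range (i + 1), x j + 1 - hits x u (i + 1) else nextStart x u i

/-- The left end points of the intervals on which the systematic sample is constant. -/
noncomputable def starts (n : ℕ) (x : ℕ → ℝ) : ℕ → ℝ
  | 0 => 0
  | j + 1 => nextStart x (starts n x j) n

variable {x : ℕ → ℝ} {n ℓ m : ℕ} {u u' : ℝ}

theorem nextStart_le {i : ℕ} (h1 : 1 ≤ i) (hin : i ≤ n) (h : 0 < hits x u i) :
    nextStart x u n ≤ ∑ j ∈ Finset.range i, x j + 1 - hits x u i := by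
  induction n with
  | zero => omega
  | succ n ih =>
    rw [nextStart]
    rcases hin.lt_or_eq with h2 | rfl
    · have := ih (by omega)
      split_ifs with h3
      · exact h3.2.le.trans this
      · exact this
    · split_ifs with h3
      · exact le_rfl
      · exact not_lt.1 fun h4 => h3 ⟨h, h4⟩

theorem nextStart_eq (x : ℕ → ℝ) (u : ℝ) (n : ℕ) : nextStart x u n = 1 ∨
    ∃ i, 1 ≤ i ∧ i ≤ n ∧ 0 < hits x u i ∧
      nextStart x u n = ∑ j ∈ Finset.range i, x j + 1 - hits x u i := by
  induction n with
  | zero => exact Or.inl rfl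
  | succ n ih =>
    rw [nextStart]
    split_ifs with h
    · exact Or.inr ⟨n + 1, by omega, le_rfl, h.1, rfl⟩
    · rcases ih with h2 | ⟨i, h2, h3, h4⟩
      · exact Or.inl h2
      · exact Or.inr ⟨i, h2, by omega, h4⟩

theorem nextStart_le_one (x : ℕ → ℝ) (u : ℝ) (n : ℕ) : nextStart x u n ≤ 1 := by
  induction n with
  | zero => exact le_rfl
  | succ n ih =>
    rw [nextStart]
    split_ifs with h
    exacts [h.2.le.trans ih, ih]

theorem lt_of_hits_pos {i : ℕ} (h : 0 < hits x u i) :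
    u < ∑ j ∈ Finset.range i, x j + 1 - hits x u i := by
  have h2 : hits x u i - 1 < hits x u i := by omega
  rw [lt_hits_iff, Nat.cast_sub h] at h2
  push_cast at h2
  linarith

theorem lt_nextStart (hu : u < 1) (n : ℕ) : u < nextStart x u n := by
  rcases nextStart_eq x u n with h | ⟨i, -, -, h, h'⟩
  · rwa [h]
  · rw [h']; exact lt_of_hits_pos h

/-- Counts can only decrease as the starting point grows, and the count below the `i`-th partial sum
first drops at `∑ + 1 - hits`, which is at or beyond `nextStart`. -/
theorem hits_eq_of_lt_nextStart (h0 : 0 ≤ u) (hu : u ≤ u') (hu' : u' < nextStart x u n) {i : ℕ}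
    (hi : i ≤ n) : hits x u' i = hits x u i := by
  rcases i with _ | i
  · rw [hits_zero h0, hits_zero (h0.trans hu)]
  have h1 : hits x u' (i + 1) ≤ hits x u (i + 1) := Nat.ceil_le_ceil (by linarith)
  refine le_antisymm h1 ?_
  rcases Nat.eq_zero_or_pos (hits x u (i + 1)) with h | h
  · omega
  have h2 := nextStart_le (by omega) hi h
  have h3 : hits x u (i + 1) - 1 < hits x u' (i + 1) := by
    rw [lt_hits_iff, Nat.cast_sub h]
    push_cast
    linarith
  omega

theorem systematic_eq_of_lt_nextStart (h0 : 0 ≤ u) (hu : u ≤ u') (hu' : u' < nextStart x u n) :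
    systematic n x u' = systematic n x u := by
  ext i
  simp only [systematic, Finset.mem_filter, Finset.mem_univ, true_and]
  rw [hits_eq_of_lt_nextStart h0 hu hu' (show (i : ℕ) + 1 ≤ n from i.2),
    hits_eq_of_lt_nextStart h0 hu hu' i.2.le]

/-- Below `1`, `nextStart` is the drop point of some count. That count never recovers, whereas equal
samples would have equal counts. -/
theorem systematic_ne_of_nextStart_le (hx0 : ∀ i, 0 ≤ x i) (hx1 : ∀ i, x i ≤ 1) (h0 : 0 ≤ u)
    (hu : u < 1) (hu' : nextStart x u n ≤ u') (hu1 : u' < 1) :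
    systematic n x u ≠ systematic n x u' := by
  intro h
  rcases nextStart_eq x u n with h2 | ⟨i, -, h2, h3, h4⟩
  · linarith
  have h5 := hits_eq_of_systematic_eq hx0 hx1 h0
    (h0.trans ((lt_nextStart hu n).le.trans hu')) h h2
  rw [h5] at h3 h4
  have := lt_of_hits_pos h3
  linarith

theorem starts_lt_of_lt (hm : ∀ j < m, starts n x j < 1) {j j' : ℕ} (hj : j < j') (hj' : j' ≤ m) :
    starts n x j < starts n x j' := by
  induction j', hj using Nat.le_induction with
  | base => exact lt_nextStart (hm j hj') n
  | succ k hk ih => exact (ih (by omega)).trans (lt_nextStart (hm k hj') n)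

theorem starts_nonneg (hm : ∀ j < m, starts n x j < 1) {j : ℕ} (hj : j ≤ m) :
    0 ≤ starts n x j := by
  rcases Nat.eq_zero_or_pos j with rfl | h
  · exact le_rfl
  · exact (starts_lt_of_lt hm h hj).le

/-- The starts increase strictly, and each one after the first is the fractional part of a partial
sum of index between `1` and `n - 1`. -/
theorem le_of_starts_lt (hx : ∑ j ∈ Finset.range n, x j = ℓ) (hn : 1 ≤ n)
    (hm : ∀ j < m, starts n x j < 1) : m ≤ n := by
  have hcard : (Finset.Ico 1 m).card ≤ ((Finset.Ico 1 n).image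
      fun i => Int.fract (∑ j ∈ Finset.range i, x j)).card := by
    refine Finset.card_le_card_of_injOn (starts n x) ?_ ?_
    · intro j hj
      obtain ⟨hj1, hj2⟩ := Finset.mem_Ico.1 (Finset.mem_coe.1 hj)
      obtain ⟨j, rfl⟩ := Nat.exists_eq_add_of_le' hj1
      have hlt := hm _ hj2
      have hnn := starts_nonneg hm hj2.le
      rcases nextStart_eq x (starts n x j) n with h | ⟨i, h1, h2, -, h3⟩
      · rw [starts, h] at hlt
        exact absurd hlt (lt_irrefl _)
      · rw [← starts] at h3
        refine Finset.mem_coe.2 (Finset.mem_image.2 ⟨i, Finset.mem_Ico.2 ⟨h1, ?_⟩, ?_⟩)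
        -- Index `n` is excluded: its count is `ℓ`, so its drop point would be `1`.
        · refine lt_of_le_of_ne h2 fun h4 => ?_
          rw [h4, hx, hits_last hx (starts_nonneg hm (by omega)) (hm j (by omega))] at h3
          linarith
        · rw [Int.fract_eq_iff]
          refine ⟨hnn, hlt, hits x (starts n x j) i - 1, ?_⟩
          rw [h3]
          push_cast
          ring
    · intro j hj j' hj' h
      have h1 := (Finset.mem_Ico.1 (Finset.mem_coe.1 hj)).2
      have h2 := (Finset.mem_Ico.1 (Finset.mem_coe.1 hj')).2
      rcases lt_trichotomy j j' with h3 | h3 | h3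
      · exact absurd h (starts_lt_of_lt hm h3 h2.le).ne
      · exact h3
      · exact absurd h (starts_lt_of_lt hm h3 h1.le).ne'
  have := hcard.trans Finset.card_image_le
  simp only [Nat.card_Ico] at this
  omega

theorem systematic_starts_ne (hx0 : ∀ i, 0 ≤ x i) (hx1 : ∀ i, x i ≤ 1)
    (hm : ∀ j < m, starts n x j < 1) {j j' : ℕ} (hj : j < j') (hj' : j' < m) :
    systematic n x (starts n x j) ≠ systematic n x (starts n x j') := by
  refine systematic_ne_of_nextStart_le hx0 hx1 (starts_nonneg hm (by omega)) (hm j (by omega)) ?_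
    (hm j' hj')
  change starts n x (j + 1) ≤ _
  rcases (show j + 1 ≤ j' from hj).lt_or_eq with h | h
  · exact (starts_lt_of_lt hm h hj'.le).le
  · rw [h]

theorem injOn_systematic_starts (hx0 : ∀ i, 0 ≤ x i) (hx1 : ∀ i, x i ≤ 1)
    (hm : ∀ j < m, starts n x j < 1) :
    InjOn (fun j => systematic n x (starts n x j)) (Iio m) := by
  intro j hj j' hj' h
  rcases lt_trichotomy j j' with h3 | h3 | h3
  · exact absurd h (systematic_starts_ne hx0 hx1 hm h3 hj')
  · exact h3
  · exact absurd h.symm (systematic_starts_ne hx0 hx1 hm h3 hj)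

theorem exists_mem_interval (hm : ∀ j < m, starts n x j < 1) (h0 : 0 ≤ u)
    (hu : u < starts n x m) : ∃ j < m, u ∈ Ico (starts n x j) (starts n x (j + 1)) := by
  induction m with
  | zero => exact absurd hu (not_lt.2 h0)
  | succ m ih =>
    by_cases h : u < starts n x m
    · obtain ⟨j, hj, h2⟩ := ih (fun j hj => hm j (by omega)) h
      exact ⟨j, by omega, h2⟩
    · exact ⟨m, by omega, not_lt.1 h, hu⟩

theorem systematic_eq_of_mem_interval (hm : ∀ j < m, starts n x j < 1) {j : ℕ} (hj : j < m)
    (hu : u ∈ Ico (starts n x j) (starts n x (j + 1))) :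
    systematic n x u = systematic n x (starts n x j) :=
  systematic_eq_of_lt_nextStart (starts_nonneg hm hj.le) hu.1 hu.2

/-- The pieces cover `[0, 1)` and carry distinct samples, so the fibre of a sample is exactly its
own piece. -/
theorem systematicLaw_starts (hx0 : ∀ i, 0 ≤ x i) (hx1 : ∀ i, x i ≤ 1)
    (hm : ∀ j < m, starts n x j < 1) (hm1 : starts n x m = 1) {j : ℕ} (hj : j < m)
    {S : Subsets n ℓ} (hS : systematic n x (starts n x j) = S.1) :
    systematicLaw n ℓ x S = starts n x (j + 1) - starts n x j := by
  have h1 : starts n x (j + 1) ≤ 1 := nextStart_le_one _ _ _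
  have e : (systematic n x ⁻¹' {S.1}) ∩ Ico 0 1
      = Ico (starts n x j) (starts n x (j + 1)) := by
    ext u
    constructor
    · rintro ⟨hu, h0, hu1⟩
      obtain ⟨j', hj', hu'⟩ := exists_mem_interval hm h0 (hm1 ▸ hu1)
      have h2 : systematic n x (starts n x j') = systematic n x (starts n x j) := by
        rw [← systematic_eq_of_mem_interval hm hj' hu', hS]; exact hu
      rwa [injOn_systematic_starts hx0 hx1 hm hj' hj h2] at hu'
    · intro hu
      refine ⟨?_, (starts_nonneg hm hj.le).trans hu.1, hu.2.trans_le h1⟩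
      exact (systematic_eq_of_mem_interval hm hj hu).trans hS
  rw [systematicLaw, unitLaw, measureReal_restrict_apply (measurableSet_systematic n x S.1), e,
    Real.volume_real_Ico_of_le (starts_lt_of_lt hm (Nat.lt_succ_self j) hj).le]

theorem exists_starts_of_systematicLaw_ne_zero (hm : ∀ j < m, starts n x j < 1)
    (hm1 : starts n x m = 1) {S : Subsets n ℓ} (hS : systematicLaw n ℓ x S ≠ 0) :
    ∃ j < m, systematic n x (starts n x j) = S.1 := by
  by_contra! h
  refine hS ?_
  have e : (systematic n x ⁻¹' {S.1}) ∩ Ico 0 1 = ∅ := by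
    ext u
    simp only [mem_inter_iff, mem_preimage, mem_singleton_iff, mem_empty_iff_false, iff_false]
    rintro ⟨hu, h0, hu1⟩
    obtain ⟨j, hj, hu'⟩ := exists_mem_interval hm h0 (hm1 ▸ hu1)
    exact h j hj (by rw [← systematic_eq_of_mem_interval hm hj hu', hu])
  rw [systematicLaw, unitLaw, measureReal_restrict_apply (measurableSet_systematic n x S.1), e,
    measureReal_empty]

end intervals

/-! ## Reasoning about programs -/

/-- Started in the state `s`, the program `c` halts after at most `T` steps in a state satisfying
`Q`. -/
def Runs (c : Prog) (s : State) (T : ℕ) (Q : State → Prop) : Prop :=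
  ∃ k ≤ T, ∃ s', Exec c s k s' ∧ Q s'

/-- Programs without loops. -/
def Prog.LoopFree : Prog → Prop
  | .seq c d => c.LoopFree ∧ d.LoopFree
  | .cond _ c d => c.LoopFree ∧ d.LoopFree
  | .loop _ _ => False
  | _ => True

open Classical in
/-- Result of a program without loops. -/
noncomputable def Prog.run : Prog → State → State
  | .skip, s => s
  | .setN x e, s => s.setN x (e.eval s)
  | .setR x e, s => s.setR x (e.eval s)
  | .storeN a i e, s => s.storeN a (i.eval s) (e.eval s)
  | .storeR a i e, s => s.storeR a (i.eval s) (e.eval s)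
  | .draw x, s => s.draw x
  | .seq c d, s => d.run (c.run s)
  | .cond b c d, s => if b.eval s then c.run s else d.run s
  | .loop _ _, s => s

/-- Upper bound for the number of steps of a program without loops. -/
def Prog.maxCost : Prog → ℕ
  | .skip => 1
  | .setN _ e => e.cost + 1
  | .setR _ e => e.cost + 1
  | .storeN _ i e => i.cost + e.cost + 1
  | .storeR _ i e => i.cost + e.cost + 1
  | .draw _ => 1
  | .seq c d => c.maxCost + d.maxCost
  | .cond b c d => b.cost + (c.maxCost + d.maxCost) + 1
  | .loop _ _ => 0

theorem Prog.LoopFree.runs {c : Prog} (hc : c.LoopFree) (s : State) {Q : State → Prop}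
    (hQ : Q (c.run s)) : Runs c s c.maxCost Q := by
  suffices h : ∃ k ≤ c.maxCost, Exec c s k (c.run s) by
    obtain ⟨k, hk, h⟩ := h
    exact ⟨k, hk, _, h, hQ⟩
  clear hQ
  induction c generalizing s with
  | skip => exact ⟨_, le_rfl, .skip s⟩
  | setN x e => exact ⟨_, le_rfl, .setN s x e⟩
  | setR x e => exact ⟨_, le_rfl, .setR s x e⟩
  | storeN a i e => exact ⟨_, le_rfl, .storeN s a i e⟩
  | storeR a i e => exact ⟨_, le_rfl, .storeR s a i e⟩
  | draw x => exact ⟨_, le_rfl, .draw s x⟩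
  | seq c d ihc ihd =>
    obtain ⟨k, hk, h1⟩ := ihc hc.1 s
    obtain ⟨k', hk', h2⟩ := ihd hc.2 (c.run s)
    exact ⟨_, Nat.add_le_add hk hk', .seq h1 h2⟩
  | cond b c d ihc ihd =>
    by_cases hb : b.eval s
    · obtain ⟨k, hk, h1⟩ := ihc hc.1 s
      refine ⟨_, ?_, by rw [Prog.run, if_pos hb]; exact .condTrue hb h1⟩
      rw [Prog.maxCost]; omega
    · obtain ⟨k, hk, h1⟩ := ihd hc.2 s
      refine ⟨_, ?_, by rw [Prog.run, if_neg hb]; exact .condFalse hb h1⟩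
      rw [Prog.maxCost]; omega
  | loop b c => exact hc.elim

/-! ### Rules for sequencing and for loops with a decreasing measure -/

section rules

variable {c d : Prog} {b : BExp} {s : State} {T U : ℕ} {P Q : State → Prop}

theorem Runs.mono (h : Runs c s T P) (hT : T ≤ U) (hQ : ∀ s', P s' → Q s') : Runs c s U Q := by
  obtain ⟨k, hk, s', h1, h2⟩ := h
  exact ⟨k, hk.trans hT, s', h1, hQ s' h2⟩

theorem Runs.seq (h : Runs c s T P) (h' : ∀ s', P s' → Runs d s' U Q) :
    Runs (.seq c d) s (T + U) Q := by
  obtain ⟨k, hk, s', h1, h2⟩ := h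
  obtain ⟨k', hk', s'', h3, h4⟩ := h' s' h2
  exact ⟨_, Nat.add_le_add hk hk', s'', .seq h1 h3, h4⟩

/-- A loop whose body decreases the measure `μ` and keeps the invariant `P`. -/
theorem Runs.loop (μ : State → ℕ)
    (hstep : ∀ s, P s → b.eval s → Runs c s T fun s' => P s' ∧ μ s' < μ s) {m : ℕ}
    (hs : P s) (hm : μ s ≤ m) :
    Runs (.loop b c) s ((m + 1) * (T + b.cost + 1)) fun s' => P s' ∧ ¬ b.eval s' := by
  induction m generalizing s with
  | zero =>
    by_cases hb : b.eval s
    · obtain ⟨_, _, s', _, _, h⟩ := hstep s hs hb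
      omega
    · exact ⟨_, by omega, s, .loopStop hb, hs, hb⟩
  | succ m ih =>
    by_cases hb : b.eval s
    · obtain ⟨k, hk, s', h1, h2, h3⟩ := hstep s hs hb
      obtain ⟨k', hk', s'', h4, h5⟩ := ih h2 (by omega)
      refine ⟨_, ?_, s'', .loopStep hb h1 h4, h5⟩
      rw [Nat.succ_mul (m + 1)]
      omega
    · refine ⟨_, ?_, s, .loopStop hb, hs, hb⟩
      rw [Nat.succ_mul (m + 1)]
      omega

end rules

/-! ## Computing an optimal threshold solution -/

section solve

/-- The real constant `1`. -/
abbrev RExp.one : RExp := .ofNat (.lit 1)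

/-- The state holds the input, and nothing has been output yet. -/
structure HasInput (V : ℕ → ℝ) (n t ℓ : ℕ) (s : State) : Prop where
  size : s.nvar 0 = n
  empty : s.nvar 1 = t
  opened : s.nvar 2 = ℓ
  values : s.rarr 0 = V
  rows : s.narr 0 = fun _ => 0

/-- The search goes on as long as a smaller threshold is preferable.  The natural-number variables
`3` and `4` hold `r` and `k`, the real variables `0` and `1` hold `invSum V r` and `tau`. -/
def searchGuard : BExp :=
  .and (.ltN (.var 4) (.var 0)) (.ltR (.ofNat (.var 3))
    (.add (.ofNat (.var 1)) (.mul (.arr 0 (.var 4)) (.var 0))))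

/-- Move on to the next breakpoint. -/
def searchBody : Prog :=
  .cond (.ltR (.ofNat (.var 2)) (.add (.mul (.arr 0 (.var 3)) (.var 0))
      (.sub (.add (.ofNat (.var 4)) .one) (.ofNat (.var 3)))))
    (.seq (.setR 0 (.add (.var 0) (.div .one (.arr 0 (.var 3)))))
      (.cond (.ltN (.var 3) (.var 4))
        (.seq (.setR 1 (.arr 0 (.var 3))) (.setN 3 (.add (.var 3) (.lit 1))))
        (.seq (.setR 1 (.div (.ofNat (.var 2)) (.var 0)))
          (.seq (.setN 3 (.add (.var 3) (.lit 1))) (.setN 4 (.add (.var 4) (.lit 1)))))))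
    (.seq (.setR 1 (.div (.sub (.ofNat (.var 2))
        (.sub (.add (.ofNat (.var 4)) .one) (.ofNat (.var 3)))) (.var 0)))
      (.setN 4 (.add (.var 4) (.lit 1))))

/-- Start of the search. -/
def searchStart : Prog :=
  .seq (.setN 3 (.lit 1)) (.seq (.setN 4 (.var 2)) (.setR 0 (.div .one (.arr 0 (.lit 0)))))

/-- Start of writing the opening probabilities; the real variable `2` holds the probability of
box `k`. -/
def fillStart : Prog :=
  .seq (.setR 2 (.sub (.sub (.ofNat (.var 2)) (.mul (.var 1) (.var 0)))
    (.sub (.ofNat (.var 4)) (.ofNat (.var 3))))) (.setN 5 (.lit 0))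

/-- Write the opening probability of the box in the natural-number variable `5`. -/
def fillBody : Prog :=
  .seq (.cond (.ltN (.var 5) (.var 3)) (.storeR 2 (.var 5) (.div (.var 1) (.arr 0 (.var 5))))
    (.cond (.ltN (.var 5) (.var 4)) (.storeR 2 (.var 5) .one)
      (.cond (.ltN (.var 5) (.add (.var 4) (.lit 1))) (.storeR 2 (.var 5) (.var 2))
        (.storeR 2 (.var 5) (.ofNat (.lit 0))))))
    (.setN 5 (.add (.var 5) (.lit 1)))

/-- Compute the opening probabilities of an optimal distribution into the real array `2`. -/
def solve : Prog :=
  .seq (.seq searchStart (.loop searchGuard searchBody))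
    (.seq fillStart (.loop (.ltN (.var 5) (.var 0)) fillBody))

variable {V : ℕ → ℝ} {n t ℓ : ℕ} {s : State}

/-- Invariant of the search loop. -/
structure SearchState (V : ℕ → ℝ) (n t ℓ : ℕ) (s : State) : Prop extends
    HasInput V n t ℓ s where
  sum : s.rvar 0 = invSum V (s.nvar 3)
  inv : SearchInv V n ℓ (s.nvar 3) (s.nvar 4)
  breakpoint : searchGuard.eval s ∨ IsBreakpoint V n t ℓ (s.nvar 3) (s.nvar 4) (s.rvar 1)

/-- The branches of the body are the three events of the search. Each raises `r` or `k` without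
exceeding `n`, whence at most `2 * n` iterations. -/
theorem SearchState.step (hV : IsValues V n) (hℓ : 1 ≤ ℓ) (h : SearchState V n t ℓ s)
    (hg : searchGuard.eval s) : Runs searchBody s searchBody.maxCost fun s' =>
      SearchState V n t ℓ s' ∧ s'.nvar 0 - s'.nvar 3 + (s'.nvar 0 - s'.nvar 4) <
        s.nvar 0 - s.nvar 3 + (s.nvar 0 - s.nvar 4) := by
  obtain ⟨⟨hn, ht, hl, hv, hr⟩, hsum, hinv, -⟩ := h
  simp only [searchGuard, BExp.eval, NExp.eval, RExp.eval, hn, ht, hv, hsum] at hg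
  obtain ⟨hk, hs⟩ := hg
  have hrk := hinv.r_le
  refine Prog.LoopFree.runs (by simp [searchBody, Prog.LoopFree]) s ?_
  by_cases hc : (ℓ : ℝ) < V (s.nvar 3) * invSum V (s.nvar 3) + (s.nvar 4 + 1 - s.nvar 3)
  · rcases hrk.lt_or_eq with h1 | h1
    · obtain ⟨h2, h3⟩ := hinv.lower_level hV hk hs hc h1
      have e : searchBody.run s = ((s.setR 0 (s.rvar 0 + 1 / V (s.nvar 3))).setR 1
          (V (s.nvar 3))).setN 3 (s.nvar 3 + 1) := by
        simp [searchBody, Prog.run, BExp.eval, NExp.eval, RExp.eval, State.setR, State.setN,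
          hl, hv, hsum, hc, h1]
      rw [e]
      refine ⟨⟨⟨hn, ht, hl, hv, hr⟩, ?_, h2, Or.inr h3⟩, ?_⟩
      · simp [State.setR, State.setN, hsum, invSum_succ]
      · simp only [State.setR, State.setN, Function.update_apply]
        simp
        omega
    · rw [← h1] at hk hs hc
      obtain ⟨h2, h3⟩ := searchInv_extend_level hV hk hℓ hs hc
      have e : searchBody.run s = (((s.setR 0 (invSum V (s.nvar 3 + 1))).setR 1
          (ℓ / invSum V (s.nvar 3 + 1))).setN 3 (s.nvar 3 + 1)).setN 4 (s.nvar 3 + 1) := by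
        rw [h1, add_sub_cancel_left] at hc
        simp [searchBody, Prog.run, BExp.eval, NExp.eval, RExp.eval, State.setR, State.setN,
          hl, hv, hsum, hc, h1, invSum_succ]
      rw [e]
      refine ⟨⟨⟨hn, ht, hl, hv, hr⟩, ?_, h2, Or.inr h3⟩, ?_⟩
      · simp [State.setR, State.setN]
      · simp only [State.setR, State.setN, Function.update_apply]
        simp
        omega
  · obtain ⟨h2, h3⟩ := hinv.fill hV hk hs hc
    have e : searchBody.run s = (s.setR 1 ((ℓ - (s.nvar 4 + 1 - s.nvar 3)) /
        invSum V (s.nvar 3))).setN 4 (s.nvar 4 + 1) := by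
      simp [searchBody, Prog.run, BExp.eval, NExp.eval, RExp.eval, State.setR, State.setN,
        hl, hv, hsum, hc]
    rw [e]
    refine ⟨⟨⟨hn, ht, hl, hv, hr⟩, hsum, h2, Or.inr h3⟩, ?_⟩
    simp only [State.setR, State.setN, Function.update_apply]
    simp
    omega

theorem search_runs (hV : IsValues V n) (ht : 1 ≤ t) (hℓ : 1 ≤ ℓ) (hn : ℓ < n)
    (hs : HasInput V n t ℓ s) :
    Runs (.seq searchStart (.loop searchGuard searchBody)) s
      (searchStart.maxCost + (2 * n + 1) * (searchBody.maxCost + searchGuard.cost + 1))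
      fun s' => SearchState V n t ℓ s' ∧ ¬ searchGuard.eval s' := by
  refine Runs.seq (P := fun s' => SearchState V n t ℓ s') ?_ fun s' h' => ?_
  · refine Prog.LoopFree.runs (by simp [searchStart, Prog.LoopFree]) s ?_
    obtain ⟨h1, h2, h3, h4, h5⟩ := hs
    have e : searchStart.run s = ((s.setN 3 1).setN 4 ℓ).setR 0 (1 / V 0) := by
      simp [searchStart, Prog.run, NExp.eval, RExp.eval, State.setR, State.setN, h3, h4]
    rw [e]
    refine ⟨⟨h1, h2, h3, h4, h5⟩, ?_, SearchInv.init hV hℓ hn, Or.inl ?_⟩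
    · simp [State.setR, State.setN, invSum]
    · have := search_init hV hn ht
      simpa [searchGuard, BExp.eval, NExp.eval, RExp.eval, State.setR, State.setN, h1, h2, h4]
        using And.intro hn this
  · refine Runs.loop (fun s => s.nvar 0 - s.nvar 3 + (s.nvar 0 - s.nvar 4))
      (fun s h hb => h.step hV hℓ hb) h' ?_
    have := h'.size
    omega

theorem fill_runs (x : ℕ → ℝ)
    (hx : x = searchResult V ℓ (s.nvar 3) (s.nvar 4) (s.rvar 1))
    (hs : HasInput V n t ℓ s) (hsum : s.rvar 0 = invSum V (s.nvar 3)) :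
    Runs (.seq fillStart (.loop (.ltN (.var 5) (.var 0)) fillBody)) s
      (fillStart.maxCost + (n + 1) * (fillBody.maxCost + 3 + 1))
      fun s' => HasInput V n t ℓ s' ∧ ∀ i < n, s'.rarr 2 i = x i := by
  set r := s.nvar 3 with hr
  set k := s.nvar 4 with hk
  set tau := s.rvar 1 with htau
  set e : ℝ := ℓ - tau * invSum V r - (k - r) with he
  let P : State → Prop := fun s' => HasInput V n t ℓ s' ∧ s'.nvar 3 = r ∧ s'.nvar 4 = k ∧
    s'.rvar 1 = tau ∧ s'.rvar 2 = e ∧ ∀ i < s'.nvar 5, s'.rarr 2 i = x i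
  refine Runs.seq (P := fun s' => P s' ∧ s'.nvar 5 = 0) ?_ fun s' h' => ?_
  · refine Prog.LoopFree.runs (by simp [fillStart, Prog.LoopFree]) s ?_
    obtain ⟨h1, h2, h3, h4, h5⟩ := hs
    have e1 : fillStart.run s = (s.setR 2 e).setN 5 0 := by
      simp [fillStart, Prog.run, NExp.eval, RExp.eval, State.setR, State.setN, h3, hsum, he, htau,
        hr, hk]
    rw [e1]
    exact ⟨⟨⟨h1, h2, h3, h4, h5⟩, rfl, rfl, rfl, rfl, fun i hi => absurd hi (Nat.not_lt_zero i)⟩,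
      rfl⟩
  · refine (Runs.loop (P := P) (fun s => s.nvar 0 - s.nvar 5) ?_ h'.1
      (show s'.nvar 0 - s'.nvar 5 ≤ n by have := h'.1.1.size; omega)).mono le_rfl ?_
    · rintro s ⟨⟨h1, h2, h3, h4, h5⟩, h6, h7, h8, h9, h10⟩ hb
      replace hb : s.nvar 5 < s.nvar 0 := hb
      refine Prog.LoopFree.runs (by simp [fillBody, Prog.LoopFree]) s ?_
      have e1 : fillBody.run s = (s.storeR 2 (s.nvar 5) (x (s.nvar 5))).setN 5 (s.nvar 5 + 1) := by
        rw [hx, searchResult, threshold, ← he]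
        simp only [fillBody, Prog.run, BExp.eval, NExp.eval, RExp.eval, h4, h6, h7, h8, h9]
        split_ifs <;> simp [State.storeR, State.setN]
      rw [e1]
      refine ⟨⟨⟨h1, h2, h3, ?_, h5⟩, h6, h7, h8, h9, ?_⟩, ?_⟩
      · simp [State.storeR, State.setN, h4]
      · intro i hi
        simp only [State.storeR, State.setN, Function.update_apply, if_true] at hi ⊢
        split_ifs with h
        · rw [h]
        · exact h10 i (by omega)
      · simp only [State.storeR, State.setN, Function.update_apply]
        simp
        omega
    · rintro s ⟨⟨h1, -, -, -, -, h2⟩, h3⟩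
      exact ⟨h1, fun i hi => h2 i (by have := h1.size; simp only [BExp.eval, NExp.eval] at h3; omega)⟩

/-- The number of steps of `solve` is at most `solveCost * n`. -/
def solveCost : ℕ := searchStart.maxCost + 3 * (searchBody.maxCost + searchGuard.cost + 1) +
  (fillStart.maxCost + 2 * (fillBody.maxCost + 3 + 1))

theorem solve_runs (hV : IsValues V n) (ht : 1 ≤ t) (htn : t < n) (hℓ : 1 ≤ ℓ) (hn : ℓ < n)
    (hs : HasInput V n t ℓ s) :
    ∃ x : ℕ → ℝ, (∀ i, 0 ≤ x i) ∧ (∀ i, x i ≤ 1) ∧ ∑ i ∈ Finset.range n, x i = ℓ ∧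
      IsOptimal (fun i : Fin n => V i) t (systematicLaw n ℓ x) ∧
      Runs solve s (solveCost * n) fun s' => HasInput V n t ℓ s' ∧ ∀ i < n, s'.rarr 2 i = x i := by
  obtain ⟨T, hT, s', hex, h, hg⟩ := search_runs hV ht hℓ hn hs
  have hb := h.breakpoint.resolve_left hg
  have hdone : ¬ (s'.nvar 4 < n ∧
      (s'.nvar 3 : ℝ) < t + V (s'.nvar 4) * invSum V (s'.nvar 3)) := by
    simpa only [searchGuard, BExp.eval, NExp.eval, RExp.eval, h.size, h.empty, h.values, h.sum]
      using hg
  refine ⟨_, searchResult_nonneg hV hb, searchResult_le_one hV h.inv hb,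
    sum_searchResult h.inv hb, isOptimal_searchResult hV htn h.inv hb hdone, ?_⟩
  obtain ⟨U, hU, s'', hex', h'⟩ := fill_runs _ rfl h.toHasInput h.sum
  refine ⟨T + U, (Nat.add_le_add hT hU).trans ?_, s'', .seq hex hex', h'⟩
  have hn1 : 1 ≤ n := by omega
  rw [solveCost]
  generalize searchStart.maxCost = a
  generalize searchBody.maxCost + searchGuard.cost + 1 = b
  generalize fillStart.maxCost = c
  generalize fillBody.maxCost + 3 + 1 = d
  nlinarith [Nat.mul_le_mul_left a hn1, Nat.mul_le_mul_left b hn1, Nat.mul_le_mul_left c hn1,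
    Nat.mul_le_mul_left d hn1]

end solve

/-! ## Drawing the systematic sample -/

section rows

/-- Select the current box if the next point lies below the partial sum in the real variable `3`:
the real variable `4` holds the starting point, the natural-number variable `6` the number of points
seen so far, the natural-number variable `8` the address of the output cell. -/
def rowSelect : Prog :=
  .cond (.ltR (.add (.var 4) (.ofNat (.var 6))) (.var 3))
    (.seq (.storeN 0 (.var 8) (.lit 1)) (.setN 6 (.add (.var 6) (.lit 1)))) .skip

/-- Update the end of the interval of starting points with the same sample. -/
def rowNext : Prog :=
  .cond (.and (.ltN (.lit 0) (.var 6))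
      (.ltR (.sub (.add (.var 3) .one) (.ofNat (.var 6))) (.var 5)))
    (.setR 5 (.sub (.add (.var 3) .one) (.ofNat (.var 6)))) .skip

/-- Process the box in the natural-number variable `5`. -/
def rowBody : Prog :=
  .seq (.setR 3 (.add (.var 3) (.arr 2 (.var 5)))) (.seq rowSelect (.seq rowNext
    (.seq (.setN 5 (.add (.var 5) (.lit 1))) (.setN 8 (.add (.var 8) (.lit 1))))))

/-- Start of a row. -/
def rowStart : Prog :=
  .seq (.setN 5 (.lit 0)) (.seq (.setN 6 (.lit 0)) (.seq (.setR 3 (.ofNat (.lit 0)))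
    (.setR 5 .one)))

/-- Write the systematic sample with the starting point in the real variable `4` to the cells that
begin at the address in the natural-number variable `8`, and compute the end of the interval of
starting points with the same sample. -/
def row : Prog := .seq rowStart (.loop (.ltN (.var 5) (.var 0)) rowBody)

/-- The first `i` boxes of the row at the address `a` of a memory that held `s₀` before have been
processed. -/
structure RowState (x : ℕ → ℝ) (n a : ℕ) (u : ℝ) (s₀ : State) (i : ℕ) (s : State) : Prop where
  size : s.nvar 0 = n
  index : s.nvar 5 = i
  count : s.nvar 6 = hits x u i
  number : s.nvar 7 = s₀.nvar 7
  address : s.nvar 8 = a + i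
  sum : s.rvar 3 = ∑ j ∈ Finset.range i, x j
  start : s.rvar 4 = u
  next : s.rvar 5 = nextStart x u i
  rarr : s.rarr = s₀.rarr
  before : ∀ q < a, s.narr 0 q = s₀.narr 0 q
  selected : ∀ j < i, s.narr 0 (a + j) = 1 ↔ hits x u j < hits x u (j + 1)
  after : ∀ q, a + i ≤ q → s.narr 0 q = 0

variable {x : ℕ → ℝ} {n a i : ℕ} {u : ℝ} {s₀ s : State}

/-- Comparing `u + hits x u i` with the new partial sum asks whether the next point lies below it,
which replaces computing a ceiling. -/
theorem run_rowSelect (hx0 : 0 ≤ x i) (hx1 : x i ≤ 1) (h3 : s.nvar 6 = hits x u i)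
    (h5 : s.nvar 8 = a) (h6 : s.rvar 3 = ∑ j ∈ Finset.range (i + 1), x j) (h7 : s.rvar 4 = u) :
    rowSelect.run s = { s with
      nvar := Function.update s.nvar 6 (hits x u (i + 1))
      narr := if hits x u i < hits x u (i + 1) then
        Function.update s.narr 0 (Function.update (s.narr 0) a 1) else s.narr } := by
  have hsel : (u + hits x u i < ∑ j ∈ Finset.range (i + 1), x j) ↔
      hits x u i < hits x u (i + 1) := by
    rw [lt_hits_iff, lt_sub_iff_add_lt']
  have hsucc := hits_succ (u := u) hx0 hx1
  simp only [rowSelect, Prog.run, BExp.eval, RExp.eval, NExp.eval, h3, h5, h6, h7, hsel]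
  by_cases hs : hits x u i < hits x u (i + 1)
  · rw [if_pos hs, if_pos hs]
    rw [if_pos hs] at hsucc
    rw [hsucc, ← h3]
    rfl
  · rw [if_neg hs, if_neg hs]
    rw [if_neg hs, add_zero] at hsucc
    rw [hsucc, ← h3, Function.update_eq_self]

theorem run_rowNext (h3 : s.nvar 6 = hits x u (i + 1))
    (h6 : s.rvar 3 = ∑ j ∈ Finset.range (i + 1), x j) (h8 : s.rvar 5 = nextStart x u i) :
    rowNext.run s = s.setR 5 (nextStart x u (i + 1)) := by
  simp only [rowNext, Prog.run, BExp.eval, RExp.eval, NExp.eval, h3, h6, h8, Nat.cast_one]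
  rw [nextStart]
  split_ifs with h
  · rfl
  · rw [← h8, State.setR, Function.update_eq_self]

theorem RowState.step (hx0 : ∀ i, 0 ≤ x i) (hx1 : ∀ i, x i ≤ 1) (hx : s₀.rarr 2 i = x i)
    (h : RowState x n a u s₀ i s) :
    Runs rowBody s rowBody.maxCost (RowState x n a u s₀ (i + 1)) := by
  obtain ⟨h1, h2, h3, h4, h5, h6, h7, h8, h9, h10, h11, h12⟩ := h
  refine Prog.LoopFree.runs (by simp [rowBody, rowSelect, rowNext, Prog.LoopFree]) s ?_
  have e : rowBody.run s = State.mk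
      (Function.update (Function.update (Function.update s.nvar 6 (hits x u (i + 1))) 5 (i + 1)) 8
        (a + i + 1))
      (Function.update (Function.update s.rvar 3 (∑ j ∈ Finset.range (i + 1), x j)) 5
        (nextStart x u (i + 1)))
      (if hits x u i < hits x u (i + 1) then
        Function.update s.narr 0 (Function.update (s.narr 0) (a + i) 1) else s.narr)
      s.rarr s.tape := by
    have e1 : (Prog.setR 3 (.add (.var 3) (.arr 2 (.var 5)))).run s
        = s.setR 3 (∑ j ∈ Finset.range (i + 1), x j) := by
      rw [Finset.sum_range_succ]
      simp only [Prog.run, RExp.eval, NExp.eval, h2, h6, h9, hx]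
    rw [rowBody, Prog.run, e1, Prog.run, run_rowSelect (a := a + i) (u := u) (hx0 i) (hx1 i)
      (by simpa [State.setR] using h3) (by simpa [State.setR] using h5) (by simp [State.setR])
      (by simpa [State.setR] using h7), Prog.run, run_rowNext (x := x) (u := u) (i := i)
      (by simp) (by simp [State.setR]) (by simpa [State.setR] using h8)]
    simp [Prog.run, NExp.eval, State.setR, State.setN, h2, h5]
  rw [e]
  refine ⟨?_, ?_, ?_, ?_, ?_, ?_, ?_, ?_, ?_, ?_, ?_, ?_⟩
  · simpa using h1
  · simp
  · simp
  · simpa using h4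
  · simp [add_assoc]
  · simp
  · simpa using h7
  · simp
  · exact h9
  · intro q hq
    dsimp only
    split_ifs
    · rw [Function.update_self, Function.update_of_ne (by omega)]; exact h10 q hq
    · exact h10 q hq
  · intro j hj
    dsimp only
    rcases (Nat.lt_succ_iff.1 hj).lt_or_eq with hj | rfl
    · split_ifs
      · rw [Function.update_self, Function.update_of_ne (by omega)]; exact h11 j hj
      · exact h11 j hj
    · split_ifs with hs
      · simp [hs]
      -- Cells of unselected boxes are never written; their `0` is the initial content recorded by
      -- `after`.
      · simp [hs, h12]
  · intro q hq
    dsimp only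
    split_ifs
    · rw [Function.update_self, Function.update_of_ne (by omega)]; exact h12 q (by omega)
    · exact h12 q (by omega)

/-- The number of steps of `row` is at most `rowCost * n`. -/
def rowCost : ℕ := rowStart.maxCost + 2 * (rowBody.maxCost + 3 + 1)

theorem row_runs (hx0 : ∀ i, 0 ≤ x i) (hx1 : ∀ i, x i ≤ 1) (hn : 1 ≤ n) (hu : 0 ≤ u)
    (hsize : s₀.nvar 0 = n) (haddr : s₀.nvar 8 = a) (hstart : s₀.rvar 4 = u)
    (hx : ∀ i < n, s₀.rarr 2 i = x i) (hzero : ∀ q, a ≤ q → s₀.narr 0 q = 0) :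
    Runs row s₀ (rowCost * n) (RowState x n a u s₀ n) := by
  refine Runs.mono (T := rowStart.maxCost + (n + 1) * (rowBody.maxCost + 3 + 1))
    (Runs.seq (P := RowState x n a u s₀ 0) ?_ fun s h => ?_) ?_ fun _ h => h
  · refine Prog.LoopFree.runs (by simp [rowStart, Prog.LoopFree]) s₀ ?_
    have e : rowStart.run s₀ = (((s₀.setN 5 0).setN 6 0).setR 3 0).setR 5 1 := by
      simp [rowStart, Prog.run, NExp.eval, RExp.eval]
    rw [e]
    exact ⟨hsize, rfl, (hits_zero hu).symm, rfl, haddr, by simp [State.setR], hstart, rfl, rfl,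
      fun _ _ => rfl, fun j hj => absurd hj (Nat.not_lt_zero j), hzero⟩
  · refine (Runs.loop (P := fun s => ∃ i ≤ n, RowState x n a u s₀ i s)
      (fun s => s.nvar 0 - s.nvar 5) ?_ ⟨0, Nat.zero_le n, h⟩
      (show s.nvar 0 - s.nvar 5 ≤ n by rw [h.size]; omega)).mono le_rfl ?_
    · rintro s ⟨i, -, h⟩ hb
      simp only [BExp.eval, NExp.eval, h.index, h.size] at hb
      refine (h.step hx0 hx1 (hx i hb)).mono le_rfl fun s' h' => ⟨⟨i + 1, hb, h'⟩, ?_⟩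
      rw [h.index, h.size, h'.index, h'.size]
      omega
    · rintro s ⟨⟨i, hi, h⟩, hb⟩
      simp only [BExp.eval, NExp.eval, h.index, h.size] at hb
      obtain rfl : i = n := by omega
      exact h
  · rw [rowCost]
    generalize rowStart.maxCost = c
    generalize rowBody.maxCost + 3 + 1 = d
    nlinarith [Nat.mul_le_mul_left c hn, Nat.mul_le_mul_left d hn]

theorem RowState.outputRow_eq {j : ℕ} (h : RowState x n (j * n) u s₀ n s) :
    outputRow n s j = systematic n x u := by
  ext i
  simp only [outputRow, systematic, Finset.mem_filter, Finset.mem_univ, true_and]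
  exact h.selected i i.2

end rows

/-! ## The tape is irrelevant for programs without randomness -/

section tape

variable {s s' : State}

/-- Replace the random numbers. -/
def State.withTape (s : State) (ω : Tape) : State := { s with tape := ω }

theorem NExp.eval_withTape (e : NExp) (ω : Tape) : e.eval (s.withTape ω) = e.eval s := by
  induction e with
  | lit | var => rfl
  | arr a i ih => simp only [NExp.eval, ih]; rfl
  | add e f he hf | sub e f he hf => simp only [NExp.eval, he, hf]

theorem RExp.eval_withTape (e : RExp) (ω : Tape) : e.eval (s.withTape ω) = e.eval s := by
  induction e with
  | var => rfl
  | arr a i => simp only [RExp.eval, NExp.eval_withTape]; rfl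
  | ofNat e => simp only [RExp.eval, NExp.eval_withTape]
  | add e f he hf | sub e f he hf | mul e f he hf | div e f he hf => simp only [RExp.eval, he, hf]

theorem BExp.eval_withTape (b : BExp) (ω : Tape) : b.eval (s.withTape ω) ↔ b.eval s := by
  induction b with
  | ltN e f => simp only [BExp.eval, NExp.eval_withTape]
  | ltR e f => simp only [BExp.eval, RExp.eval_withTape]
  | not b h => simp only [BExp.eval, h]
  | and b c hb hc => simp only [BExp.eval, hb, hc]

theorem Exec.withTape {c : Prog} {T : ℕ} (h : Exec c s T s') (hc : c.DrawFree) (ω : Tape) :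
    Exec c (s.withTape ω) T (s'.withTape ω) := by
  induction h with
  | skip s => exact .skip _
  | setN s x e => have := Exec.setN (s.withTape ω) x e; rwa [NExp.eval_withTape] at this
  | setR s x e => have := Exec.setR (s.withTape ω) x e; rwa [RExp.eval_withTape] at this
  | storeN s a i e =>
    have := Exec.storeN (s.withTape ω) a i e
    rwa [NExp.eval_withTape, NExp.eval_withTape] at this
  | storeR s a i e =>
    have := Exec.storeR (s.withTape ω) a i e
    rwa [NExp.eval_withTape, RExp.eval_withTape] at this
  | draw => exact hc.elim
  | seq _ _ ih₁ ih₂ => exact .seq (ih₁ hc.1) (ih₂ hc.2)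
  | condTrue hb _ ih => exact .condTrue ((BExp.eval_withTape _ ω).2 hb) (ih hc.1)
  | condFalse hb _ ih => exact .condFalse (mt (BExp.eval_withTape _ ω).1 hb) (ih hc.2)
  | loopStop hb => exact .loopStop (mt (BExp.eval_withTape _ ω).1 hb)
  | loopStep hb _ _ ih₁ ih₂ =>
    exact .loopStep ((BExp.eval_withTape _ ω).2 hb) (ih₁ hc) (ih₂ hc)

end tape

theorem solve_drawFree : solve.DrawFree := by
  simp [solve, searchStart, searchBody, fillStart, fillBody, Prog.DrawFree]

theorem row_drawFree : row.DrawFree := by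
  simp [row, rowStart, rowBody, rowSelect, rowNext, Prog.DrawFree]

/-! ### Correctness of the two programs on actual inputs -/

section main

variable {n t ℓ : ℕ} {v : Fin n → ℝ}

/-- The values of the boxes, continued by zeros. -/
noncomputable def extend (v : Fin n → ℝ) (i : ℕ) : ℝ := if h : i < n then v ⟨i, h⟩ else 0

theorem isValues_extend (hpos : ∀ i, 0 < v i) (hv : Antitone v) : IsValues (extend v) n := by
  refine ⟨fun i j hij => ?_, fun i hi => ?_, fun i hi => ?_⟩
  · by_cases hj : j < n
    · rw [extend, extend, dif_pos hj, dif_pos (hij.trans_lt hj)]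
      exact hv (by simpa using hij)
    · rw [extend, dif_neg hj, extend]
      split_ifs
      exacts [(hpos _).le, le_rfl]
  · rw [extend, dif_pos hi]; exact hpos _
  · rw [extend, dif_neg (by omega)]

theorem extend_coe (v : Fin n → ℝ) : (fun i : Fin n => extend v i) = v := by
  ext i; simp [extend]

theorem hasInput_initState (v : Fin n → ℝ) (t ℓ : ℕ) (ω : Tape) :
    HasInput (extend v) n t ℓ (initState v t ℓ ω) :=
  ⟨rfl, rfl, rfl, rfl, rfl⟩

/-- The vector `x` must not depend on the tape. It is obtained from the zero tape, and the draw-free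
run is then transported to every other tape. -/
theorem solve_initState (ht : 1 ≤ t) (htn : t < n) (hℓ : 1 ≤ ℓ) (hn : ℓ < n)
    (hpos : ∀ i, 0 < v i) (hv : Antitone v) :
    ∃ x : ℕ → ℝ, (∀ i, 0 ≤ x i) ∧ (∀ i, x i ≤ 1) ∧ ∑ i ∈ Finset.range n, x i = ℓ ∧
      IsOptimal v t (systematicLaw n ℓ x) ∧
      ∀ ω, Runs solve (initState v t ℓ ω) (solveCost * n) fun s =>
        HasInput (extend v) n t ℓ s ∧ (∀ i < n, s.rarr 2 i = x i) ∧ s.tape = ω := by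
  obtain ⟨x, h0, h1, hx, hopt, T, hT, s, hex, h, hs⟩ := solve_runs (isValues_extend hpos hv) ht htn
    hℓ hn (hasInput_initState v t ℓ fun _ => 0)
  rw [extend_coe] at hopt
  refine ⟨x, h0, h1, hx, hopt, fun ω => ⟨T, hT, s.withTape ω, hex.withTape solve_drawFree ω, ?_⟩⟩
  obtain ⟨h2, h3, h4, h5, h6⟩ := h
  exact ⟨⟨h2, h3, h4, h5, h6⟩, hs, rfl⟩

/-! ## Sampling in linear time -/

/-- Draw the starting point into the real variable `4`. -/
def drawStart : Prog :=
  .seq (.draw 4) (.seq (.cond (.ltR (.var 4) .one) .skip (.setR 4 (.ofNat (.lit 0))))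
    (.setN 8 (.lit 0)))

/-- Sample from an optimal distribution. -/
def sampler : Prog := .seq solve (.seq drawStart row)

/-- The random numbers from `[0, 1]` are moved to `[0, 1)`. -/
noncomputable def startPoint (r : ℝ) : ℝ := if r < 1 then r else 0

theorem startPoint_mem {r : ℝ} (h : 0 ≤ r) : startPoint r ∈ Ico (0 : ℝ) 1 := by
  unfold startPoint
  split_ifs with h1
  exacts [⟨h, h1⟩, ⟨le_rfl, zero_lt_one⟩]

theorem measurable_startPoint : Measurable startPoint :=
  Measurable.ite measurableSet_Iio measurable_id measurable_const

/-- The number of steps of `sampler` is at most `samplerCost * n`. -/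
def samplerCost : ℕ := solveCost + drawStart.maxCost + rowCost

theorem sampler_runs {x : ℕ → ℝ} {s : State} {ω : Tape} (h0 : ∀ i, 0 ≤ x i) (h1 : ∀ i, x i ≤ 1)
    (hn : 1 ≤ n) (h : Runs solve s (solveCost * n) fun s =>
      HasInput (extend v) n t ℓ s ∧ (∀ i < n, s.rarr 2 i = x i) ∧ s.tape = ω) :
    Runs sampler s (samplerCost * n) fun s' =>
      outputRow n s' 0 = systematic n x (startPoint (ω 0)) := by
  refine Runs.mono (T := solveCost * n + (drawStart.maxCost + rowCost * n))
    (Runs.seq h fun s ⟨hin, hs, htape⟩ => Runs.seq (P := fun s' => s' =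
      ((s.draw 4).setR 4 (startPoint (ω 0))).setN 8 0) ?_ ?_) ?_ fun _ h => h
  · refine Prog.LoopFree.runs (by simp [drawStart, Prog.LoopFree]) s ?_
    simp only [drawStart, Prog.run, BExp.eval, NExp.eval, RExp.eval, startPoint, ← htape]
    by_cases hlt : (s.tape 0 : ℝ) < 1 <;> simp [State.draw, State.setR, State.setN, hlt]
  · rintro s' rfl
    refine (row_runs (s₀ := ((s.draw 4).setR 4 (startPoint (ω 0))).setN 8 0) (a := 0 * n) h0
      h1 hn (startPoint_mem (ω 0).2.1).1 hin.size (Nat.zero_mul n).symm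
      (by simp [State.setN, State.setR]) hs fun q _ => ?_).mono le_rfl fun s'' h'' => ?_
    · exact congrFun hin.rows q
    · exact h''.outputRow_eq
  · rw [samplerCost]
    nlinarith [Nat.mul_le_mul_left drawStart.maxCost hn]

/-- Moving the draw `1` to `0` affects only a null set, and the first coordinate of the tape is
uniform. -/
theorem tapeLaw_startPoint (n : ℕ) (x : ℕ → ℝ) (S : Finset (Fin n)) :
    tapeLaw.real {ω | systematic n x (startPoint (ω 0)) = S}
      = unitLaw.real (systematic n x ⁻¹' {S}) := by
  have hmp : MeasurePreserving (fun ω : Tape => (ω 0 : ℝ)) tapeLaw (volume.restrict unitInterval) :=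
    unitInterval.measurePreserving_coe.comp (measurePreserving_eval_infinitePi _ 0)
  have hA : MeasurableSet (startPoint ⁻¹' (systematic n x ⁻¹' {S})) :=
    measurable_startPoint (measurableSet_systematic n x S)
  have e : (volume.restrict unitInterval : Measure ℝ) = unitLaw :=
    (Measure.restrict_congr_set Ico_ae_eq_Icc).symm
  have h1 := hmp.measureReal_preimage hA.nullMeasurableSet
  rw [e] at h1
  refine Eq.trans h1 (measureReal_congr ?_)
  filter_upwards [unitLaw_ae_mem] with u hu
  have : startPoint u = u := if_pos hu.2
  apply propext
  change systematic n x (startPoint u) = S ↔ systematic n x u = S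
  rw [this]

theorem samplesWithin_sampler {x : ℕ → ℝ} (h0 : ∀ i, 0 ≤ x i) (h1 : ∀ i, x i ≤ 1) (hn : 1 ≤ n)
    (hx : ∑ i ∈ Finset.range n, x i = ℓ)
    (h : ∀ ω, Runs solve (initState v t ℓ ω) (solveCost * n) fun s =>
      HasInput (extend v) n t ℓ s ∧ (∀ i < n, s.rarr 2 i = x i) ∧ s.tape = ω) :
    SamplesWithin sampler v t ℓ (samplerCost * n) (systematicLaw n ℓ x) := by
  have hrun := fun ω => sampler_runs h0 h1 hn (h ω)
  refine ⟨fun ω => ?_, fun S => ?_⟩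
  · obtain ⟨k, hk, s, hex, hs⟩ := hrun ω
    have hu := startPoint_mem (ω 0).2.1
    exact ⟨k, hk, s, hex, by rw [hs, card_systematic h0 h1 hx hu.1 hu.2]⟩
  · rw [systematicLaw, ← tapeLaw_startPoint]
    congr 1
    ext ω
    obtain ⟨k, -, s, hex, hs⟩ := hrun ω
    constructor
    · rintro ⟨k', s', hex', hs'⟩
      -- Determinism makes the existential event depend only on the run already constructed.
      obtain ⟨-, rfl⟩ := hex.deterministic hex'
      exact hs.symm.trans hs'
    · intro hS
      exact ⟨k, s, hex, hs.trans hS⟩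

/-! ## Listing the distribution in quadratic time -/

/-- Start of the list. -/
def listStart : Prog :=
  .seq (.setN 7 (.lit 0)) (.seq (.setN 8 (.lit 0)) (.setR 4 (.ofNat (.lit 0))))

/-- Write the probability of the row and move on to the next one. -/
def listStep : Prog :=
  .seq (.storeR 1 (.var 7) (.sub (.var 5) (.var 4))) (.seq (.setR 4 (.var 5))
    (.setN 7 (.add (.var 7) (.lit 1))))

/-- Compute an explicit description of an optimal distribution. -/
def lister : Prog :=
  .seq solve (.seq (.seq listStart (.loop (.ltR (.var 4) .one) (.seq row listStep)))
    (.setN 0 (.var 7)))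

theorem lister_drawFree : lister.DrawFree :=
  ⟨solve_drawFree, ⟨by simp [listStart, Prog.DrawFree], row_drawFree,
    by simp [listStep, Prog.DrawFree]⟩, trivial⟩

/-- The first `m` rows of the list have been written. -/
structure ListState (x : ℕ → ℝ) (n m : ℕ) (s : State) : Prop where
  size : s.nvar 0 = n
  number : s.nvar 7 = m
  address : s.nvar 8 = m * n
  start : s.rvar 4 = starts n x m
  start_lt : ∀ j < m, starts n x j < 1
  marginals : ∀ i < n, s.rarr 2 i = x i
  rows : ∀ j < m, outputRow n s j = systematic n x (starts n x j)
  probs : ∀ j < m, s.rarr 1 j = starts n x (j + 1) - starts n x j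
  after : ∀ q, m * n ≤ q → s.narr 0 q = 0

/-- The end of the piece computed by a row is the next start. The output address simply runs on
between rows, so no multiplication of natural numbers is needed. -/
theorem ListState.step {x : ℕ → ℝ} {m : ℕ} {s : State} (h0 : ∀ i, 0 ≤ x i) (h1 : ∀ i, x i ≤ 1)
    (hn : 1 ≤ n) (h : ListState x n m s) (hm : starts n x m < 1) :
    Runs (.seq row listStep) s (rowCost * n + listStep.maxCost) (ListState x n (m + 1)) := by
  refine Runs.seq (row_runs h0 h1 hn (starts_nonneg h.start_lt le_rfl) h.size h.address h.start
    h.marginals h.after) fun s' h' => ?_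
  refine Prog.LoopFree.runs (by simp [listStep, Prog.LoopFree]) s' ?_
  have e : listStep.run s' = ((s'.storeR 1 m (starts n x (m + 1) - starts n x m)).setR 4
      (starts n x (m + 1))).setN 7 (m + 1) := by
    have h2 : s'.nvar 7 = m := h'.number.trans h.number
    have h3 : s'.rvar 5 = starts n x (m + 1) := h'.next
    simp [listStep, Prog.run, NExp.eval, RExp.eval, State.storeR, State.setR, State.setN, h2, h3,
      h'.start]
  rw [e]
  refine ⟨h'.size, rfl, ?_, rfl, ?_, ?_, ?_, ?_, ?_⟩
  · rw [Nat.succ_mul]; exact h'.address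
  · intro j hj
    rcases (Nat.lt_succ_iff.1 hj).lt_or_eq with hj | rfl
    exacts [h.start_lt j hj, hm]
  · intro i hi
    simp only [State.storeR, State.setR, State.setN]
    rw [Function.update_of_ne (by omega), h'.rarr]
    exact h.marginals i hi
  · intro j hj
    rcases (Nat.lt_succ_iff.1 hj).lt_or_eq with hj | rfl
    · rw [← h.rows j hj]
      ext i
      simp only [outputRow, Finset.mem_filter, Finset.mem_univ, true_and]
      have hlt : j * n + i < m * n := by
        have := Nat.mul_le_mul_right n (show j + 1 ≤ m from hj)
        rw [Nat.succ_mul] at this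
        omega
      rw [← h'.before _ hlt]
      rfl
    · exact h'.outputRow_eq
  · intro j hj
    simp only [State.storeR, State.setR, State.setN]
    rw [Function.update_self]
    rcases (Nat.lt_succ_iff.1 hj).lt_or_eq with hj | rfl
    · rw [Function.update_of_ne (by omega), h'.rarr]
      exact h.probs j hj
    · rw [Function.update_self]
  · intro q hq
    exact h'.after q (by rw [Nat.succ_mul] at hq; exact hq)

/-- The number of steps of `lister` is at most `listerCost * n ^ 2`. -/
def listerCost : ℕ := solveCost + listStart.maxCost + 2 * (rowCost + listStep.maxCost + 4 + 1) + 2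

theorem lister_runs {x : ℕ → ℝ} {s : State} (h0 : ∀ i, 0 ≤ x i) (h1 : ∀ i, x i ≤ 1)
    (hn : 1 ≤ n) (hx : ∑ i ∈ Finset.range n, x i = ℓ)
    (h : Runs solve s (solveCost * n) fun s =>
      HasInput (extend v) n t ℓ s ∧ ∀ i < n, s.rarr 2 i = x i) :
    Runs lister s (listerCost * n ^ 2) fun s' =>
      s'.nvar 0 ≤ n ∧ Describes s' (systematicLaw n ℓ x) := by
  refine Runs.mono (T := solveCost * n + ((listStart.maxCost +
      (n + 1) * (rowCost * n + listStep.maxCost + 4 + 1)) + 2))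
    (Runs.seq h fun s ⟨hin, hs⟩ => Runs.seq (Runs.seq (P := ListState x n 0) ?_ fun s' h' =>
      Runs.loop (P := fun s => ∃ m ≤ n, ListState x n m s) (fun s => s.nvar 0 - s.nvar 7) ?_
        ⟨0, Nat.zero_le n, h'⟩ (show s'.nvar 0 - s'.nvar 7 ≤ n by rw [h'.size]; omega)) ?_) ?_
    fun _ h => h
  · refine Prog.LoopFree.runs (by simp [listStart, Prog.LoopFree]) s ?_
    have e : listStart.run s = ((s.setN 7 0).setN 8 0).setR 4 0 := by
      simp [listStart, Prog.run, NExp.eval, RExp.eval]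
    rw [e]
    refine ⟨hin.size, rfl, by simp [State.setN, State.setR], rfl,
      fun j hj => absurd hj (Nat.not_lt_zero j), hs, fun j hj => absurd hj (Nat.not_lt_zero j),
      fun j hj => absurd hj (Nat.not_lt_zero j), fun q _ => congrFun hin.rows q⟩
  · rintro s ⟨m, -, h⟩ hb
    simp only [BExp.eval, RExp.eval, NExp.eval, Nat.cast_one, h.start] at hb
    refine (h.step h0 h1 hn hb).mono le_rfl fun s' h' => ?_
    -- The bound on the number of pieces also makes `n` minus the row number a decreasing measure.
    have hle := le_of_starts_lt hx hn h'.start_lt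
    refine ⟨⟨m + 1, hle, h'⟩, ?_⟩
    rw [h.size, h.number, h'.size, h'.number]
    omega
  · rintro s ⟨⟨m, hmn, h⟩, hb⟩
    simp only [BExp.eval, RExp.eval, NExp.eval, Nat.cast_one, h.start, not_lt] at hb
    -- Starts are capped at `1`, so the loop exits exactly there and the listed pieces fill `[0,
    -- 1)`.
    have hm1 : starts n x m = 1 := by
      refine le_antisymm ?_ hb
      rcases m with _ | m
      exacts [zero_le_one, nextStart_le_one _ _ _]
    refine Prog.LoopFree.runs (c := .setN 0 (.var 7)) trivial s ?_
    have e : (Prog.setN 0 (.var 7)).run s = s.setN 0 m := by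
      simp only [Prog.run, NExp.eval, h.number]
    rw [e]
    have hrow : ∀ j < m, outputRow n (s.setN 0 m) j = systematic n x (starts n x j) := h.rows
    have hnum : (s.setN 0 m).nvar 0 = m := by simp [State.setN]
    rw [Describes, hnum]
    refine ⟨hmn, (injOn_systematic_starts h0 h1 h.start_lt).congr fun j hj => (hrow j hj).symm,
      fun j hj => ?_, fun S hS => ?_⟩
    · have hcard := card_systematic h0 h1 hx (starts_nonneg h.start_lt hj.le) (h.start_lt j hj)
      have hlaw := systematicLaw_starts (S := ⟨_, hcard⟩) h0 h1 h.start_lt hm1 hj rfl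
      refine ⟨⟨_, hcard⟩, ?_, hrow j hj, ?_⟩
      · rw [hlaw]
        exact (sub_pos.2 (starts_lt_of_lt h.start_lt (Nat.lt_succ_self j) hj)).ne'
      · rw [hlaw]; exact h.probs j hj
    · obtain ⟨j, hj, hS'⟩ := exists_starts_of_systematicLaw_ne_zero h.start_lt hm1 hS
      exact ⟨j, hj, (hrow j hj).trans hS'⟩
  · rw [listerCost]
    generalize solveCost = a
    generalize listStart.maxCost = b
    generalize rowCost = c
    generalize listStep.maxCost = d
    have hn1 : 1 ≤ n ^ 2 := Nat.one_le_pow _ _ hn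
    have hn2 : n ≤ n ^ 2 := Nat.le_self_pow two_ne_zero n
    nlinarith [Nat.mul_le_mul_left a hn2, Nat.mul_le_mul_left b hn1, Nat.mul_le_mul_left c hn2,
      Nat.mul_le_mul_left d hn1, Nat.mul_le_mul_left d hn2]

theorem Describes.ncard_support_le {p : Subsets n ℓ → ℝ} {s : State} (h : Describes s p) :
    (Function.support p).ncard ≤ s.nvar 0 := by
  have hsub : Subtype.val '' Function.support p ⊆
      ((Finset.range (s.nvar 0)).image (outputRow n s) : Set (Finset (Fin n))) := by
    rintro _ ⟨S, hS, rfl⟩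
    obtain ⟨j, hj, hjS⟩ := h.2.2 S hS
    exact Finset.mem_coe.2 (Finset.mem_image.2 ⟨j, Finset.mem_range.2 hj, hjS⟩)
  rw [← ncard_image_of_injective _ Subtype.val_injective]
  refine (ncard_le_ncard hsub (Finset.finite_toSet _)).trans ?_
  rw [ncard_coe_finset]
  exact Finset.card_image_le.trans (Finset.card_range _).le

end main

end Byzantine

/-- A single program samples in linear time from an optimal distribution, and a single program
without randomness computes explicitly, in quadratic time, an optimal distribution with support of
size at most `n`; the constants do not depend on the input. -/
theorem mainTheorem1 :
    (∃ (c : Byzantine.Prog) (C : ℕ), ∀ (n t ℓ : ℕ) (v : Fin n → ℝ),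
      1 ≤ t → t < n → 1 ≤ ℓ → ℓ < n → (∀ i, 0 < v i) → Antitone v →
      ∃ p : Byzantine.Subsets n ℓ → ℝ,
        Byzantine.IsOptimal v t p ∧ Byzantine.SamplesWithin c v t ℓ (C * n) p) ∧
    (∃ (c : Byzantine.Prog) (C : ℕ), ∀ (n t ℓ : ℕ) (v : Fin n → ℝ),
      1 ≤ t → t < n → 1 ≤ ℓ → ℓ < n → (∀ i, 0 < v i) → Antitone v →
      ∃ p : Byzantine.Subsets n ℓ → ℝ,
        Byzantine.IsOptimal v t p ∧ (Function.support p).ncard ≤ n ∧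
        Byzantine.ComputesWithin c v t ℓ (C * n ^ 2) p) := by
  refine ⟨⟨Byzantine.sampler, Byzantine.samplerCost, fun n t ℓ v ht htn hℓ hn hpos hv => ?_⟩,
    ⟨Byzantine.lister, Byzantine.listerCost, fun n t ℓ v ht htn hℓ hn hpos hv => ?_⟩⟩
  · obtain ⟨x, h0, h1, hx, hopt, hrun⟩ := Byzantine.solve_initState ht htn hℓ hn hpos hv
    exact ⟨_, hopt, Byzantine.samplesWithin_sampler h0 h1 (by omega) hx hrun⟩
  · obtain ⟨x, h0, h1, hx, hopt, hrun⟩ := Byzantine.solve_initState ht htn hℓ hn hpos hv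
    have hlist := fun ω => Byzantine.lister_runs h0 h1 (by omega) hx
      ((hrun ω).mono le_rfl fun _ h => ⟨h.1, h.2.1⟩)
    refine ⟨_, hopt, ?_, Byzantine.lister_drawFree, fun ω => ?_⟩
    · obtain ⟨_, _, s, _, hs, hd⟩ := hlist fun _ => 0
      exact hd.ncard_support_le.trans hs
    · obtain ⟨k, hk, s, hex, -, hd⟩ := hlist ω
      exact ⟨k, hk, s, hex, hd⟩
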